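/- **Lemma 3.4 (Poisson clusters with reporting delay).** Let $0<T_1<T_2<\cdots$ be the (finitely or infinitely many) points of a non-homogeneous Poisson process on $[0,\infty)$ with locally finite intensity measure $\Lambda$, let $D_1,D_2,\dots\ge 0$ be iid reporting delays with distribution $F_D$, and let $L_1,L_2,\dots$ be iid non-homogeneous Poisson processes with mean value function $\mu(t)=\mu(0,t]<\infty$, $t\ge 0$, with $L_j(u)=0$ for $u\le 0$, where $(T_j)$, $(D_j)$ and $(L_j)$ are independent of each other. (A non-homogeneous Poisson process starts at $0$ a.s., has independent increments, Poisson distributed increments over $(a,b]$ with mean equal to the intensity of $(a,b]$, and a.s. càdlàg paths.) Put $$M(t)=\sum_{j:\,T_j\le 1}L_j\big(t-(T_j+D_j)\big),\qquad M(t,t+s]=M(t+s)-M(t),\qquad \widehat N(t)=\#\{j: T_j\le 1,\ T_j+D_j\le t\}.$$ Let $t\ge 1$, $s>0$ and $\ell\in\{0,1,2,\dots\}$ with $P(\widehat N(t)=\ell)>0$. Write $\Lambda*F_D$ for the convolution of the restriction of $\Lambda$ to $[0,1]$ with $F_D$, and set, for $i=1,2$, $$A_i=\int_{[0,t]}\mu(t-u,t+s-u]^i\,\frac{(\Lambda*F_D)(du)}{E[\widehat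 N(t)]},\qquad B_i=\int_0^1\int_{r\in(t-v,\,t+s-v]}\mu(t+s-v-r)^i\,F_D(dr)\,\Lambda(dv)$$ (if $E[\widehat N(t)]=0$, in which case necessarily $\ell=0$, read $\ell A_1=\ell A_1^2=\ell A_2=0$). Then $\widehat N(t)$ is integrable, $M(t,t+s]$ is square integrable conditionally on $\{\widehat N(t)=\ell\}$, and the predictor $\widetilde M_\ell(t,t+s]=E[M(t,t+s]\mid\widehat N(t)=\ell]$ and the conditional variance are $$\widetilde M_\ell(t,t+s]=\ell A_1+B_1,$$ $$\mathrm{Var}\big(M(t,t+s]\mid \widehat N(t)=\ell\big)=\widetilde M_\ell(t,t+s]-\ell A_1^2+\ell A_2+B_2 .$$ -/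

import Mathlib

open MeasureTheory ProbabilityTheory Set
open scoped NNReal ENNReal

/-- A (non-homogeneous) Poisson process `X = (X t)_{t ≥ 0}` with intensity measure `Λ` on `[0, ∞)`:
it starts at `0`, has independent increments, `X b - X a` is Poisson distributed with parameter
`Λ (a, b]`, and almost every path is càdlàg. The mean value function is `t ↦ Λ (0, t]`. -/
structure IsPoissonProcess {Ω : Type*} [MeasurableSpace Ω] (X : ℝ≥0 → Ω → ℝ) (Λ : Measure ℝ≥0)
    (P : Measure Ω) : Prop where
  isLocallyFiniteMeasure : IsLocallyFiniteMeasure Λ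
  intensity_zero : Λ {0} = 0
  measurable : ∀ t, Measurable (X t)
  start_zero : ∀ᵐ ω ∂P, X 0 ω = 0
  indep_increments : HasIndepIncrements X P
  law_increment : ∀ a b : ℝ≥0, a ≤ b →
    P.map (fun ω => X b ω - X a ω) =
      (poissonMeasure (Λ (Ioc a b)).toNNReal).map (Nat.cast : ℕ → ℝ)
  cadlag : ∀ᵐ ω ∂P, ∀ t : ℝ≥0,
    ContinuousWithinAt (fun u => X u ω) (Ici t) t ∧
      ∃ l : ℝ, Filter.Tendsto (fun u => X u ω) (nhdsWithin t (Iio t)) (nhds l)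

namespace DelayedCluster

/-- The counting process `N(t) = #{j : T j ≤ t}` of a sequence of points. -/
noncomputable def centerCount {Ω : Type*} (T : ℕ → Ω → ℝ≥0∞) (t : ℝ≥0) (ω : Ω) : ℝ :=
  ({j : ℕ | T j ω ≤ (t : ℝ≥0∞)}.ncard : ℝ)

/-- The number `N̂(t) = #{j : T j + D j ≤ t, T j ≤ 1}` of claims that arrived in `[0, 1]` and
are reported by time `t`. -/
noncomputable def reportedCount {Ω : Type*} (T : ℕ → Ω → ℝ≥0∞) (D : ℕ → Ω → ℝ≥0)
    (t : ℝ≥0) (ω : Ω) : ℕ :=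
  {j : ℕ | T j ω + (D j ω : ℝ≥0∞) ≤ (t : ℝ≥0∞) ∧ T j ω ≤ 1}.ncard

open Classical in
/-- The cluster process `M(t) = ∑_j 1_{T j ≤ 1} L_j(t - (T j + D j))`. The subtraction in `ℝ≥0` is
truncated at `0`, which together with `L_j 0 = 0` a.s. is the convention `L_j u = 0` for `u ≤ 0`.
Almost surely only finitely many terms are nonzero. -/
noncomputable def clusterProcess {Ω : Type*} (T : ℕ → Ω → ℝ≥0∞) (D : ℕ → Ω → ℝ≥0)
    (L : ℕ → ℝ≥0 → Ω → ℝ) (t : ℝ≥0) (ω : Ω) : ℝ :=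
  ∑' j : ℕ, if T j ω ≤ 1 then L j (t - ((T j ω).toNNReal + D j ω)) ω else 0

/-- The future increment `M(t, t+s] = M(t+s) - M(t)`. -/
noncomputable def increment {Ω : Type*} (T : ℕ → Ω → ℝ≥0∞) (D : ℕ → Ω → ℝ≥0)
    (L : ℕ → ℝ≥0 → Ω → ℝ) (t s : ℝ≥0) (ω : Ω) : ℝ :=
  clusterProcess T D L (t + s) ω - clusterProcess T D L t ω

/-- The conditional law `P(· | N̂(t) = ℓ)`. -/
noncomputable def condReported {Ω : Type*} [MeasurableSpace Ω] (P : Measure Ω)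
    (T : ℕ → Ω → ℝ≥0∞) (D : ℕ → Ω → ℝ≥0) (t : ℝ≥0) (ℓ : ℕ) : Measure Ω :=
  ProbabilityTheory.cond P {ω | reportedCount T D t ω = ℓ}

/-- The expected number of reported claims `E[N̂(t)]`. -/
noncomputable def meanReported {Ω : Type*} [MeasurableSpace Ω] (P : Measure Ω)
    (T : ℕ → Ω → ℝ≥0∞) (D : ℕ → Ω → ℝ≥0) (t : ℝ≥0) : ℝ :=
  ∫ ω, (reportedCount T D t ω : ℝ) ∂P

/-- The predictor `E[M(t, t+s] | N̂(t) = ℓ]`. -/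
noncomputable def predictor {Ω : Type*} [MeasurableSpace Ω] (P : Measure Ω)
    (T : ℕ → Ω → ℝ≥0∞) (D : ℕ → Ω → ℝ≥0) (L : ℕ → ℝ≥0 → Ω → ℝ) (t s : ℝ≥0) (ℓ : ℕ) : ℝ :=
  ∫ ω, increment T D L t s ω ∂(condReported P T D t ℓ)

/-- The Poisson cluster model with reporting delay.
`T 0 < T 1 < ⋯` are the points of a Poisson process with intensity measure `Λ` (with `T j = ∞` if
there are at most `j` points), `D j` are the iid reporting delays with distribution `F_D`, and `L j`
are iid Poisson processes with intensity measure `μ`; `T`, `D`, `L` are mutually independent. -/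
structure IsModel {Ω : Type*} [MeasurableSpace Ω] (P : Measure Ω)
    (T : ℕ → Ω → ℝ≥0∞) (D : ℕ → Ω → ℝ≥0) (L : ℕ → ℝ≥0 → Ω → ℝ)
    (Λ F_D μ : Measure ℝ≥0) : Prop where
  measurable_T : ∀ j, Measurable (T j)
  T_pos : ∀ᵐ ω ∂P, 0 < T 0 ω
  T_strict : ∀ᵐ ω ∂P, ∀ j, T j ω ≤ T (j + 1) ω ∧ (T j ω ≠ ∞ → T j ω < T (j + 1) ω)
  T_finite : ∀ᵐ ω ∂P, ∀ t : ℝ≥0, {j : ℕ | T j ω ≤ (t : ℝ≥0∞)}.Finite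
  poisson_centers : IsPoissonProcess (centerCount T) Λ P
  measurable_D : ∀ j, Measurable (D j)
  law_D : ∀ j, P.map (D j) = F_D
  indep_D : iIndepFun D P
  poisson_clusters : ∀ j, IsPoissonProcess (L j) μ P
  indep_L : iIndepFun (fun j ω u => L j u ω) P
  indep_T_L : IndepFun (fun ω j => T j ω) (fun ω j u => L j u ω) P
  indep_D_TL : IndepFun (fun ω j => D j ω)
    (fun ω => ((fun j => T j ω : ℕ → ℝ≥0∞), (fun j u => L j u ω : ℕ → ℝ≥0 → ℝ))) P

/-- `∫_0^t μ(t-u, t+s-u]^i (Λ ∗ F_D)(du) / c`, with `Λ` restricted to the arrival window `[0, 1]`. -/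
noncomputable def reportedIntegral (Λ F_D μ : Measure ℝ≥0) (c : ℝ) (t s : ℝ≥0) (i : ℕ) : ℝ :=
  (∫ u in Icc 0 t, μ.real (Ioc (t - u) (t + s - u)) ^ i
    ∂(Measure.conv (Λ.restrict (Icc 0 1)) F_D)) / c

/-- `∫_0^1 ∫_{(t-v, t+s-v]} μ(t+s-v-r)^i F_D(dr) Λ(dv)`, where `μ(w) = μ(0, w]`. -/
noncomputable def unreportedIntegral (Λ F_D μ : Measure ℝ≥0) (t s : ℝ≥0) (i : ℕ) : ℝ :=
  ∫ v in Icc 0 1, ∫ r in Ioc (t - v) (t + s - v),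
    μ.real (Ioc 0 (t + s - v - r)) ^ i ∂F_D ∂Λ

end DelayedCluster

open DelayedCluster

/-! A point arriving at `v` is reported at `u = v + D`. Given `u`, its cluster adds to the window a
Poisson variable with mean `g(u) = μ(t-u, t+s-u]` (`meanGain`). With N̂ the reported count and M the
increment, its factor in `E[z^N̂ e^{θM}]` therefore has mean `w(u) = z^{1{u ≤ t}} exp((e^θ - 1)
g(u))` (`meanWeight`). Delays and clusters are integrated out point by point
(`IsModel.lintegral_prod_marks`). The probability generating functional of the Poisson process
(`lintegral_prod_arrivals`) then turns the product over arrivals into `exp(∫ w dK - Λ[0,1])`, where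
`K = Λ ∗ F_D` with `Λ` restricted to `[0,1]`.

Let `R(x)` and `U(x)` be the integrals of `e^{x g}` against `K` over `u ≤ t` and `u > t`. The joint
transform is `exp(z R(x) + U(x) - Λ[0,1])` at `x = e^θ - 1` (`IsModel.lintegral_pow_mul_exp`). The
exponent is affine in `z`, so comparing coefficients of `z^ℓ` shows that `E[e^{θM} | N̂ = ℓ]` is a
constant times `e^{U(x)} R(x)^ℓ`.

Hence the conditional cumulant generating function is `φ(e^θ - 1) + c` with `φ = U + ℓ log R`
(`IsModel.cgf_increment`). Its first two derivatives at `0` are `φ'(0)` and `φ''(0) + φ'(0)`, where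
`φ'(0) = B_1 + ℓ A_1` and `φ''(0) = B_2 + ℓ (A_2 - A_1²)`. The summand `φ'(0)` is why the predictor
reappears in the variance. -/

/-! ### Poisson transforms and independent marks. -/

/-- The probability generating function of the Poisson distribution. -/
theorem lintegral_pow_poissonMeasure (r c : ℝ≥0) :
    ∫⁻ n, (c : ℝ≥0∞) ^ n ∂(poissonMeasure r) = ENNReal.ofReal (Real.exp (r * (c - 1))) := by
  rw [lintegral_countable']
  have h : ∀ n : ℕ, (c : ℝ≥0∞) ^ n * poissonMeasure r {n} =
      ENNReal.ofReal (Real.exp (-r) * ((r * c : ℝ) ^ n / n.factorial)) := by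
    intro n
    rw [poissonMeasure_singleton, ← ENNReal.ofReal_coe_nnreal,
      ← ENNReal.ofReal_pow c.coe_nonneg, ← ENNReal.ofReal_mul (by positivity)]
    congr 1
    ring
  simp_rw [h]
  have hs : HasSum (fun n : ℕ => Real.exp (-r) * ((r * c : ℝ) ^ n / n.factorial))
      (Real.exp (-r) * Real.exp (r * c)) := by
    refine HasSum.mul_left _ ?_
    rw [Real.exp_eq_exp_ℝ]
    exact NormedSpace.expSeries_div_hasSum_exp (r * c : ℝ)
  rw [← ENNReal.ofReal_tsum_of_nonneg (fun n => by positivity) hs.summable, hs.tsum_eq,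
    ← Real.exp_add]
  congr 2
  ring

theorem IsPoissonProcess.lintegral_comp_increment {Ω : Type*} [MeasurableSpace Ω]
    {X : ℝ≥0 → Ω → ℝ} {Λ : Measure ℝ≥0} {P : Measure Ω} (hX : IsPoissonProcess X Λ P)
    {a b : ℝ≥0} (hab : a ≤ b) {f : ℝ → ℝ≥0∞} (hf : Measurable f) :
    ∫⁻ ω, f (X b ω - X a ω) ∂P =
      ∫⁻ n : ℕ, f n ∂(poissonMeasure (Λ (Ioc a b)).toNNReal) := by
  rw [← lintegral_map (g := fun ω => X b ω - X a ω) hf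
    ((hX.measurable b).sub (hX.measurable a)), hX.law_increment a b hab,
    lintegral_map hf (by fun_prop)]

theorem IsPoissonProcess.lintegral_pow_increment {Ω : Type*} [MeasurableSpace Ω]
    {X : ℝ≥0 → Ω → ℝ} {Λ : Measure ℝ≥0} {P : Measure Ω} (hX : IsPoissonProcess X Λ P)
    {a b : ℝ≥0} (hab : a ≤ b) (c : ℝ≥0) :
    ∫⁻ ω, (c : ℝ≥0∞) ^ ⌊X b ω - X a ω⌋₊ ∂P =
      ENNReal.ofReal (Real.exp (Λ.real (Ioc a b) * (c - 1))) := by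
  rw [hX.lintegral_comp_increment hab (f := fun x => (c : ℝ≥0∞) ^ ⌊x⌋₊)
    ((Measurable.of_discrete (f := fun n : ℕ => (c : ℝ≥0∞) ^ n)).comp Nat.measurable_floor)]
  simp only [Nat.floor_natCast]
  rw [lintegral_pow_poissonMeasure]
  rfl

theorem IsPoissonProcess.lintegral_exp_increment {Ω : Type*} [MeasurableSpace Ω]
    {X : ℝ≥0 → Ω → ℝ} {Λ : Measure ℝ≥0} {P : Measure Ω} (hX : IsPoissonProcess X Λ P)
    {a b : ℝ≥0} (hab : a ≤ b) (θ : ℝ) :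
    ∫⁻ ω, ENNReal.ofReal (Real.exp (θ * (X b ω - X a ω))) ∂P =
      ENNReal.ofReal (Real.exp ((Real.exp θ - 1) * Λ.real (Ioc a b))) := by
  rw [hX.lintegral_comp_increment hab (f := fun x => ENNReal.ofReal (Real.exp (θ * x)))
    (by fun_prop)]
  have h : ∀ n : ℕ, ENNReal.ofReal (Real.exp (θ * n)) =
      ((Real.exp θ).toNNReal : ℝ≥0∞) ^ n := by
    intro n
    rw [mul_comm, Real.exp_nat_mul, ENNReal.ofReal_pow (Real.exp_pos _).le, ENNReal.ofReal]
  simp_rw [h]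
  rw [lintegral_pow_poissonMeasure, Real.coe_toNNReal _ (Real.exp_pos _).le, mul_comm]
  rfl

/-- Integrating out independent marks attached to an independent random element. -/
theorem lintegral_mul_prod_of_indepFun {Ω α β : Type*} [MeasurableSpace Ω] [MeasurableSpace α]
    [MeasurableSpace β] {P : Measure Ω} [IsProbabilityMeasure P] {X : Ω → α} {Y : ℕ → Ω → β}
    (hX : Measurable X) (hY : ∀ j, Measurable (Y j)) (hXY : IndepFun X (fun ω j => Y j ω) P)
    (hYi : iIndepFun Y P) {f : α → ℝ≥0∞} (hf : Measurable f) {k : ℕ → α → β → ℝ≥0∞}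
    (hk : ∀ j, Measurable fun p : α × β => k j p.1 p.2) (S : Finset ℕ) :
    ∫⁻ ω, f (X ω) * ∏ j ∈ S, k j (X ω) (Y j ω) ∂P =
      ∫⁻ ω, f (X ω) * ∏ j ∈ S, ∫⁻ y, k j (X ω) y ∂(P.map (Y j)) ∂P := by
  have hY' : Measurable fun ω j => Y j ω := measurable_pi_lambda _ hY
  have hF : Measurable fun p : α × (ℕ → β) => f p.1 * ∏ j ∈ S, k j p.1 (p.2 j) :=
    (hf.comp measurable_fst).mul (Finset.measurable_prod _ fun j _ => by
      exact (hk j).comp (measurable_fst.prodMk ((measurable_pi_apply j).comp measurable_snd)))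
  have h1 := lintegral_map (μ := P) hF (hX.prodMk hY')
  -- The joint law is a product measure, so `X` can be frozen while the marks are integrated.
  rw [(indepFun_iff_map_prod_eq_prod_map_map hX.aemeasurable hY'.aemeasurable).1 hXY] at h1
  have : IsProbabilityMeasure (P.map fun ω j => Y j ω) :=
    Measure.isProbabilityMeasure_map hY'.aemeasurable
  have : IsProbabilityMeasure (P.map X) := Measure.isProbabilityMeasure_map hX.aemeasurable
  rw [lintegral_prod _ hF.aemeasurable, lintegral_map hF.lintegral_prod_right' hX] at h1
  refine h1.symm.trans (lintegral_congr fun ω => ?_)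
  rw [lintegral_map (by exact hF.comp measurable_prodMk_left) hY']
  simp only
  have hm : ∀ j, Measurable (k j (X ω)) := fun j => (hk j).comp measurable_prodMk_left
  rw [lintegral_const_mul _ (Finset.measurable_prod _ fun j _ => by exact (hm j).comp (hY j))]
  congr 1
  have h2 := lintegral_prod_eq_prod_lintegral_of_indepFun S
    (fun j ω' => k j (X ω) (Y j ω')) (hYi.comp _ hm) (fun j => (hm j).comp (hY j))
  rw [h2]
  exact Finset.prod_congr rfl fun j _ => (lintegral_map (hm j) (hY j)).symm

/-! ### Uniqueness of power series coefficients. -/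

/-- With nonnegative coefficients, summability at every `z ≥ 0` is absolute summability on every
disc, so the radius is infinite. -/
theorem hasFPowerSeriesAt_ofScalars_of_hasSum {p : ℕ → ℝ} (hp : ∀ n, 0 ≤ p n) {F : ℝ → ℝ}
    (h : ∀ z : ℝ≥0, HasSum (fun n => (z : ℝ) ^ n * p n) (F z)) :
    HasFPowerSeriesAt (FormalMultilinearSeries.ofScalars ℝ p).sum
      (FormalMultilinearSeries.ofScalars ℝ p) 0 ∧
    ∀ z : ℝ≥0, (FormalMultilinearSeries.ofScalars ℝ p).sum (z : ℝ) = F z := by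
  have hs : ∀ r : ℝ≥0, (r : ℝ≥0∞) ≤ (FormalMultilinearSeries.ofScalars ℝ p).radius := by
    intro r
    refine FormalMultilinearSeries.le_radius_of_summable _ ?_
    refine (h r).summable.congr fun n => ?_
    rw [FormalMultilinearSeries.ofScalars_norm, Real.norm_of_nonneg (hp n), mul_comm]
  have hr : (FormalMultilinearSeries.ofScalars ℝ p).radius = ∞ :=
    ENNReal.eq_top_of_forall_nnreal_le hs
  refine ⟨((FormalMultilinearSeries.ofScalars ℝ p).hasFPowerSeriesOnBall
    (by rw [hr]; exact ENNReal.zero_lt_top)).hasFPowerSeriesAt, fun z => ?_⟩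
  rw [← (h z).tsum_eq]
  simp only [FormalMultilinearSeries.sum, FormalMultilinearSeries.ofScalars_apply_eq, smul_eq_mul]
  exact tsum_congr fun n => mul_comm _ _

/-- Nonnegative power series that agree on `[0, ∞)` have the same coefficients. -/
theorem coeff_eq_of_hasSum {p q : ℕ → ℝ} (hp : ∀ n, 0 ≤ p n) (hq : ∀ n, 0 ≤ q n) {F : ℝ → ℝ}
    (h : ∀ z : ℝ≥0, HasSum (fun n => (z : ℝ) ^ n * p n) (F z))
    (h' : ∀ z : ℝ≥0, HasSum (fun n => (z : ℝ) ^ n * q n) (F z)) : p = q := by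
  obtain ⟨hf, hf'⟩ := hasFPowerSeriesAt_ofScalars_of_hasSum hp h
  obtain ⟨hg, hg'⟩ := hasFPowerSeriesAt_ofScalars_of_hasSum hq h'
  have hev : (FormalMultilinearSeries.ofScalars ℝ p).sum =ᶠ[nhds 0]
      (FormalMultilinearSeries.ofScalars ℝ q).sum := by
    -- Identity theorem: agreement is known only for `z ≥ 0`, but the positive reals accumulate at
    -- `0`.
    refine (hf.analyticAt.frequently_eq_iff_eventually_eq hg.analyticAt).1 ?_
    have : ∃ᶠ z in nhdsWithin (0 : ℝ) (Ioi 0), (FormalMultilinearSeries.ofScalars ℝ p).sum z =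
        (FormalMultilinearSeries.ofScalars ℝ q).sum z := by
      refine Filter.Eventually.frequently ?_
      filter_upwards [self_mem_nhdsWithin] with z hz
      lift z to ℝ≥0 using le_of_lt hz
      rw [hf', hg']
    exact this.filter_mono (nhdsWithin_mono _ fun z hz => (ne_of_gt hz : z ≠ 0))
  exact FormalMultilinearSeries.ofScalars_series_injective ℝ ℝ
    ((hf.congr hev).eq_formalMultilinearSeries hg)

/-- The coefficients of an exponential power series are determined by its values on `[0, ∞)`. -/
theorem eq_of_tsum_pow_eq_exp {p : ℕ → ℝ≥0∞} {a b : ℝ} (ha : 0 ≤ a)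
    (h : ∀ z : ℝ≥0, ∑' n, (z : ℝ≥0∞) ^ n * p n = ENNReal.ofReal (Real.exp (z * a + b))) (n : ℕ) :
    p n = ENNReal.ofReal (Real.exp b * (a ^ n / n.factorial)) := by
  have hfin : ∀ n, p n ≠ ∞ := by
    intro n
    -- At `z = 1` the sum is finite and dominates each coefficient.
    refine ne_top_of_le_ne_top (b := ENNReal.ofReal (Real.exp ((1 : ℝ≥0) * a + b)))
      ENNReal.ofReal_ne_top ?_
    rw [← h 1]
    simpa using ENNReal.le_tsum (f := fun n => (1 : ℝ≥0∞) ^ n * p n) n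
  have hsum : ∀ z : ℝ≥0, HasSum (fun n => (z : ℝ) ^ n * (p n).toReal) (Real.exp (z * a + b)) := by
    intro z
    have h1 : (∑' n, (z : ℝ≥0∞) ^ n * p n) ≠ ∞ := by rw [h z]; exact ENNReal.ofReal_ne_top
    have h2 := ENNReal.hasSum_toReal h1
    rw [← ENNReal.tsum_toReal_eq (fun n => ENNReal.ne_top_of_tsum_ne_top h1 n), h z,
      ENNReal.toReal_ofReal (Real.exp_pos _).le] at h2
    simpa using h2
  have hsum' : ∀ z : ℝ≥0, HasSum (fun n => (z : ℝ) ^ n * (Real.exp b * (a ^ n / n.factorial)))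
      (Real.exp (z * a + b)) := by
    intro z
    rw [add_comm, Real.exp_add]
    have h3 := NormedSpace.expSeries_div_hasSum_exp (z * a : ℝ)
    rw [← Real.exp_eq_exp_ℝ] at h3
    refine (h3.mul_left (Real.exp b)).congr_fun fun n => ?_
    rw [mul_pow]
    ring
  have := congrFun (coeff_eq_of_hasSum (F := fun z => Real.exp (z * a + b))
    (fun n => ENNReal.toReal_nonneg) (fun n => by positivity) hsum hsum') n
  rw [← this, ENNReal.ofReal_toReal (hfin n)]

/-! ### Measurability of the random index set. -/

/-- There are only countably many finite subsets of `ℕ`, and countable families are measurable. -/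
theorem measurableSet_setOf_set_nat {A : Set (Set ℕ)}
    (hA : A ⊆ {s | s.Finite} ∨ Aᶜ ⊆ {s | s.Finite}) : MeasurableSet A := by
  have hc : {s : Set ℕ | s.Finite}.Countable := Set.Countable.ofPred_finite
  rcases hA with h | h
  · exact (hc.mono h).measurableSet
  · exact (hc.mono h).measurableSet.of_compl

open Classical in
/-- The finite index set of the points in the arrival window `[0, 1]`. -/
noncomputable def arrivals (τ : ℕ → ℝ≥0∞) : Finset ℕ :=
  if h : {j | τ j ≤ 1}.Finite then h.toFinset else ∅

theorem mem_arrivals {τ : ℕ → ℝ≥0∞} (h : {j | τ j ≤ 1}.Finite) {j : ℕ} :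
    j ∈ arrivals τ ↔ τ j ≤ 1 := by
  simp [arrivals, h]

theorem le_one_of_mem_arrivals {τ : ℕ → ℝ≥0∞} {j : ℕ} (hj : j ∈ arrivals τ) : τ j ≤ 1 := by
  unfold arrivals at hj
  split_ifs at hj with h
  · simpa using hj
  · simp at hj

theorem measurableSet_arrivals_eq (S : Finset ℕ) :
    MeasurableSet {τ : ℕ → ℝ≥0∞ | arrivals τ = S} := by
  have hm : Measurable fun τ : ℕ → ℝ≥0∞ => {j : ℕ | τ j ≤ 1} := by
    refine measurable_set_iff.2 fun a => ?_
    exact (measurableSet_le (measurable_pi_apply a) measurable_const).mem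
  classical
  let A : Set (Set ℕ) := {s | (if h : s.Finite then h.toFinset else ∅) = S}
  have hA : MeasurableSet A := by
    refine measurableSet_setOf_set_nat ?_
    -- The default value `∅` puts all infinite sets in the fibre over `∅`, so that fibre is
    -- cofinite-type while all others contain finite sets only.
    by_cases hS : S = ∅
    · right
      intro s hs
      by_contra hfin
      exact hs (by simpa [A, show ¬ s.Finite from hfin] using hS.symm)
    · left
      intro s hs
      by_contra hfin
      simp only [A, mem_ofPred_eq, dif_neg (show ¬ s.Finite from hfin)] at hs
      exact hS hs.symm
  have := hm hA
  exact this

/-- Exactly one term survives. Splitting by the value of the index set reduces products over random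
sets to products over fixed ones, where independence applies. -/
theorem arrivals_apply_eq_tsum {Ω : Type*} {T : ℕ → Ω → ℝ≥0∞}
    (f : Finset ℕ → Ω → ℝ≥0∞) (ω : Ω) :
    f (arrivals fun j => T j ω) ω =
      ∑' S, {τ : ℕ → ℝ≥0∞ | arrivals τ = S}.indicator 1 (fun j => T j ω) * f S ω := by
  rw [tsum_eq_single (arrivals fun j => T j ω)]
  · simp
  · intro S hS
    simp [hS.symm]

theorem measurable_indicator_arrivals {Ω : Type*} [MeasurableSpace Ω] {T : ℕ → Ω → ℝ≥0∞}
    (hT : ∀ j, Measurable (T j)) (S : Finset ℕ) :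
    Measurable fun ω => {τ : ℕ → ℝ≥0∞ | arrivals τ = S}.indicator (1 : (ℕ → ℝ≥0∞) → ℝ≥0∞)
      (fun j => T j ω) :=
  (measurable_one.indicator (measurableSet_arrivals_eq S)).comp (measurable_pi_lambda _ hT)

theorem measurable_arrivals_apply {Ω β : Type*} [MeasurableSpace Ω] [MeasurableSpace β]
    {T : ℕ → Ω → ℝ≥0∞} (hT : ∀ j, Measurable (T j)) {f : Finset ℕ → Ω → β}
    (hf : ∀ S, Measurable (f S)) : Measurable fun ω => f (arrivals fun j => T j ω) ω := by
  intro B hB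
  have h : (fun ω => f (arrivals fun j => T j ω) ω) ⁻¹' B =
      ⋃ S, (fun ω j => T j ω) ⁻¹' {τ : ℕ → ℝ≥0∞ | arrivals τ = S} ∩ f S ⁻¹' B := by
    ext ω
    simp
  rw [h]
  exact MeasurableSet.iUnion fun S =>
    (measurable_pi_lambda _ hT (measurableSet_arrivals_eq S)).inter (hf S hB)

theorem lintegral_arrivals_apply {Ω : Type*} [MeasurableSpace Ω] {T : ℕ → Ω → ℝ≥0∞}
    {P : Measure Ω} (hT : ∀ j, Measurable (T j))
    {f : Finset ℕ → Ω → ℝ≥0∞} (hf : ∀ S, Measurable (f S)) :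
    ∫⁻ ω, f (arrivals fun j => T j ω) ω ∂P =
      ∑' S, ∫⁻ ω, {τ : ℕ → ℝ≥0∞ | arrivals τ = S}.indicator 1 (fun j => T j ω) * f S ω ∂P := by
  simp_rw [arrivals_apply_eq_tsum]
  exact lintegral_tsum fun S => ((measurable_indicator_arrivals hT S).mul (hf S)).aemeasurable

/-! ### The generating functional, by approximation on a grid. -/

/-- The index of the cell `(i / M, (i + 1) / M]` containing `v`. -/
noncomputable def cellIndex (M : ℕ) (v : ℝ≥0) : ℕ := ⌈M * v⌉₊ - 1

theorem cellIndex_eq_iff {M : ℕ} (hM : M ≠ 0) {v : ℝ≥0} (hv : 0 < v) {i : ℕ} :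
    cellIndex M v = i ↔ (i / M : ℝ≥0) < v ∧ v ≤ (i + 1 : ℕ) / M := by
  have hM' : (0 : ℝ≥0) < M := by positivity
  have hpos : 0 < ⌈(M : ℝ≥0) * v⌉₊ := Nat.ceil_pos.2 (by positivity)
  rw [cellIndex, div_lt_iff₀ hM', le_div_iff₀ hM', mul_comm v, ← Nat.lt_ceil, ← Nat.ceil_le]
  omega

theorem cellIndex_lt {M : ℕ} (hM : M ≠ 0) {v : ℝ≥0} (hv : v ≤ 1) : cellIndex M v < M := by
  have : ⌈(M : ℝ≥0) * v⌉₊ ≤ M := Nat.ceil_le.2 (mul_le_of_le_one_right (by positivity) hv)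
  unfold cellIndex
  omega

theorem measurable_cellIndex (M : ℕ) : Measurable (cellIndex M) :=
  (Measurable.of_discrete (f := fun n : ℕ => n - 1)).comp
    (Nat.measurable_ceil.comp (measurable_const.mul measurable_id))

/-- Sampling at left endpoints approaches `v` from the left, so left-continuous test functions
suffice later. -/
theorem tendsto_cellIndex_div (v : ℝ≥0) :
    Filter.Tendsto (fun n : ℕ => (cellIndex (n + 1) v / (n + 1 : ℕ) : ℝ≥0)) Filter.atTop
      (nhdsWithin v (Iic v)) := by
  have hle : ∀ n : ℕ, (cellIndex (n + 1) v / (n + 1 : ℕ) : ℝ≥0) ≤ v := by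
    intro n
    rcases eq_zero_or_pos v with rfl | hv
    · simp [cellIndex]
    · exact ((cellIndex_eq_iff n.succ_ne_zero hv).1 rfl).1.le
  refine tendsto_nhdsWithin_iff.2 ⟨?_, Filter.Eventually.of_forall hle⟩
  have hge : ∀ n : ℕ, v - 1 / ((n : ℝ≥0) + 1) ≤ (cellIndex (n + 1) v / (n + 1 : ℕ) : ℝ≥0) := by
    intro n
    rcases eq_zero_or_pos v with rfl | hv
    · simp
    · have := ((cellIndex_eq_iff n.succ_ne_zero hv).1 rfl).2
      rw [tsub_le_iff_right]
      refine this.trans (le_of_eq ?_)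
      push_cast
      rw [add_div]
  refine tendsto_of_tendsto_of_tendsto_of_le_of_le ?_ tendsto_const_nhds hge hle
  have h1 : Filter.Tendsto (fun n : ℕ => 1 / ((n : ℝ≥0) + 1)) Filter.atTop (nhds 0) :=
    tendsto_one_div_add_atTop_nhds_zero_nat
  simpa using (tendsto_const_nhds (x := v)).sub h1

theorem ncard_setOf_le_eq_card_filter {τ : ℕ → ℝ≥0∞} (h : {j | τ j ≤ 1}.Finite) {x : ℝ≥0}
    (hx : x ≤ 1) :
    {j | τ j ≤ (x : ℝ≥0∞)}.ncard = ((arrivals τ).filter fun j => (τ j).toNNReal ≤ x).card := by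
  rw [← Set.ncard_coe_finset]
  congr 1
  ext j
  simp only [mem_ofPred_eq, Finset.coe_filter, mem_arrivals h]
  constructor
  · intro hj
    refine ⟨hj.trans (by exact_mod_cast hx), ?_⟩
    simpa using ENNReal.toNNReal_mono ENNReal.coe_ne_top hj
  · rintro ⟨h1, h2⟩
    rw [← ENNReal.coe_toNNReal (ne_top_of_le_ne_top ENNReal.one_ne_top h1)]
    exact_mod_cast h2

/-- Positivity of the points matters: truncated subtraction gives a point at `0` the cell index `0`,
while the increment over `(0, 1/M]` would not count it. -/
theorem centerCount_sub_eq_card_filter {Ω : Type*} {T : ℕ → Ω → ℝ≥0∞}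
    {ω : Ω} (h : {j | T j ω ≤ 1}.Finite)
    (h0 : ∀ j, 0 < T j ω) {M : ℕ} (hM : M ≠ 0) {i : ℕ} (hi : i < M) :
    centerCount T ((i + 1 : ℕ) / M) ω - centerCount T (i / M) ω =
      (((arrivals fun j => T j ω).filter fun j => cellIndex M (T j ω).toNNReal = i).card : ℝ) := by
  have hM' : (0 : ℝ≥0) < M := by positivity
  unfold centerCount
  rw [ncard_setOf_le_eq_card_filter h, ncard_setOf_le_eq_card_filter h, sub_eq_iff_eq_add,
    ← Nat.cast_add, ← Finset.card_union_of_disjoint]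
  · congr 2
    ext j
    simp only [Finset.mem_union, Finset.mem_filter]
    by_cases hj : j ∈ arrivals fun j => T j ω
    · have hj1 := le_one_of_mem_arrivals hj
      have hpos : 0 < (T j ω).toNNReal :=
        ENNReal.toNNReal_pos (h0 j).ne' (ne_top_of_le_ne_top ENNReal.one_ne_top hj1)
      have hlt : (i / M : ℝ≥0) ≤ (i + 1 : ℕ) / M := by gcongr; omega
      simp only [hj, true_and, cellIndex_eq_iff hM hpos]
      constructor
      · intro hle
        by_cases hlt' : (i / M : ℝ≥0) < (T j ω).toNNReal
        · exact Or.inl ⟨hlt', hle⟩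
        · exact Or.inr (not_lt.1 hlt')
      · rintro (⟨-, hle⟩ | hle)
        · exact hle
        · exact hle.trans hlt
    · simp [hj]
  · rw [Finset.disjoint_filter]
    intro j hj h1 h2
    have hj1 := le_one_of_mem_arrivals hj
    have hpos : 0 < (T j ω).toNNReal :=
      ENNReal.toNNReal_pos (h0 j).ne' (ne_top_of_le_ne_top ENNReal.one_ne_top hj1)
    exact absurd ((cellIndex_eq_iff hM hpos).1 h1).1 (not_lt.2 h2)
  · rw [div_le_one hM']; exact_mod_cast hi.le
  · rw [div_le_one hM']; exact_mod_cast hi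

theorem prod_arrivals_cellIndex {Ω : Type*} {T : ℕ → Ω → ℝ≥0∞}
    {ω : Ω} (h : {j | T j ω ≤ 1}.Finite)
    (h0 : ∀ j, 0 < T j ω) {M : ℕ} (hM : M ≠ 0) (c : ℕ → ℝ≥0) :
    ∏ j ∈ arrivals fun j => T j ω, (c (cellIndex M (T j ω).toNNReal) : ℝ≥0∞) =
      ∏ i ∈ Finset.range M,
        (c i : ℝ≥0∞) ^ ⌊centerCount T ((i + 1 : ℕ) / M) ω - centerCount T (i / M) ω⌋₊ := by
  rw [← Finset.prod_fiberwise_of_maps_to (t := Finset.range M)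
    (g := fun j => cellIndex M (T j ω).toNNReal)]
  · refine Finset.prod_congr rfl fun i hi => ?_
    rw [centerCount_sub_eq_card_filter h h0 hM (Finset.mem_range.1 hi), Nat.floor_natCast,
      ← Finset.prod_const]
    exact Finset.prod_congr rfl fun j hj => by rw [(Finset.mem_filter.1 hj).2]
  · intro j hj
    have hj1 := le_one_of_mem_arrivals hj
    exact Finset.mem_range.2 (cellIndex_lt hM (by
      simpa using ENNReal.toNNReal_mono ENNReal.one_ne_top hj1))

/-- The probability generating functional of a Poisson process at a step function. -/
theorem lintegral_prod_arrivals_cellIndex {Ω : Type*} [MeasurableSpace Ω] {T : ℕ → Ω → ℝ≥0∞}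
    {P : Measure Ω} {Λ : Measure ℝ≥0}
    (hX : IsPoissonProcess (centerCount T) Λ P)
    (hfin : ∀ᵐ ω ∂P, {j | T j ω ≤ 1}.Finite) (hpos : ∀ᵐ ω ∂P, ∀ j, 0 < T j ω)
    {M : ℕ} (hM : M ≠ 0) (c : ℕ → ℝ≥0) :
    ∫⁻ ω, ∏ j ∈ arrivals fun j => T j ω, (c (cellIndex M (T j ω).toNNReal) : ℝ≥0∞) ∂P =
      ENNReal.ofReal (Real.exp (∑ i ∈ Finset.range M,
        Λ.real (Ioc (i / M) ((i + 1 : ℕ) / M)) * ((c i : ℝ) - 1))) := by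
  have hmono : Monotone fun i : ℕ => (i / M : ℝ≥0) := by
    intro i j hij
    simp only
    gcongr
  -- Grouped by cell, the product becomes powers of counting increments, which are independent and
  -- Poisson.
  have hind := hX.indep_increments.nat hmono
  have hmeas : ∀ i : ℕ, Measurable fun x : ℝ => (c i : ℝ≥0∞) ^ ⌊x⌋₊ := fun i =>
    (Measurable.of_discrete (f := fun n : ℕ => (c i : ℝ≥0∞) ^ n)).comp Nat.measurable_floor
  have h1 := lintegral_prod_eq_prod_lintegral_of_indepFun (Finset.range M) _
    (hind.comp _ hmeas)
    (fun i => (hmeas i).comp ((hX.measurable _).sub (hX.measurable _)))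
  rw [lintegral_congr_ae (by
    filter_upwards [hfin, hpos] with ω h h0
    exact prod_arrivals_cellIndex h h0 hM c)]
  refine h1.trans ?_
  rw [Real.exp_sum, ENNReal.ofReal_prod_of_nonneg fun i _ => (Real.exp_pos _).le]
  exact Finset.prod_congr rfl fun i _ => hX.lintegral_pow_increment (hmono (Nat.le_succ i)) (c i)

theorem sum_cellIndex_eq_setIntegral {Λ : Measure ℝ≥0} [IsLocallyFiniteMeasure Λ] {M : ℕ}
    (hM : M ≠ 0) (f : ℕ → ℝ) :
    ∑ i ∈ Finset.range M, Λ.real (Ioc (i / M) ((i + 1 : ℕ) / M)) * f i =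
      ∫ v in Ioc 0 1, f (cellIndex M v) ∂Λ := by
  have hM' : (0 : ℝ≥0) < M := by positivity
  have hU : Ioc (0 : ℝ≥0) 1 = ⋃ i ∈ Finset.range M, Ioc (i / M : ℝ≥0) ((i + 1 : ℕ) / M) := by
    ext v
    simp only [mem_iUnion, Finset.mem_range, exists_prop, mem_Ioc]
    constructor
    · rintro ⟨h0, h1⟩
      exact ⟨_, cellIndex_lt hM h1, (cellIndex_eq_iff hM h0).1 rfl⟩
    · rintro ⟨i, hi, h1, h2⟩
      exact ⟨lt_of_le_of_lt zero_le h1, h2.trans (by rw [div_le_one hM']; exact_mod_cast hi)⟩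
  have hc : ∀ i, EqOn (fun v => f (cellIndex M v)) (fun _ => f i)
      (Ioc (i / M : ℝ≥0) ((i + 1 : ℕ) / M)) := by
    intro i v hv
    simp only
    rw [(cellIndex_eq_iff hM (lt_of_le_of_lt zero_le hv.1)).2 hv]
  have hIoc : ∀ a b : ℝ≥0, Λ (Ioc a b) ≠ ∞ := fun a b =>
    ((measure_mono Ioc_subset_Icc_self).trans_lt isCompact_Icc.measure_lt_top).ne
  rw [hU, integral_biUnion_finset]
  · refine Finset.sum_congr rfl fun i _ => ?_
    rw [setIntegral_congr_fun measurableSet_Ioc (hc i), setIntegral_const, smul_eq_mul]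
  · exact fun i _ => measurableSet_Ioc
  · intro i _ j _ hij
    refine Set.disjoint_left.2 fun v h1 h2 => hij ?_
    have hv : 0 < v := lt_of_le_of_lt zero_le h1.1
    rw [← (cellIndex_eq_iff hM hv).2 h1, (cellIndex_eq_iff hM hv).2 h2]
  · intro i _
    exact (integrableOn_const (hIoc _ _)).congr_fun (hc i).symm measurableSet_Ioc

/-- The probability generating functional of a Poisson process. -/
theorem lintegral_prod_arrivals {Ω : Type*} [MeasurableSpace Ω] {T : ℕ → Ω → ℝ≥0∞}
    {P : Measure Ω} {Λ : Measure ℝ≥0}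
    (hT : ∀ j, Measurable (T j))
    (hX : IsPoissonProcess (centerCount T) Λ P)
    (hfin : ∀ᵐ ω ∂P, {j | T j ω ≤ 1}.Finite) (hpos : ∀ᵐ ω ∂P, ∀ j, 0 < T j ω)
    {g : ℝ≥0 → ℝ≥0} (hg : ∀ v, ContinuousWithinAt g (Iic v) v) {C : ℝ≥0} (hC : ∀ v, g v ≤ C) :
    ∫⁻ ω, ∏ j ∈ arrivals fun j => T j ω, (g (T j ω).toNNReal : ℝ≥0∞) ∂P =
      ENNReal.ofReal (Real.exp (∫ v in Icc 0 1, ((g v : ℝ) - 1) ∂Λ)) := by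
  have := hX.isLocallyFiniteMeasure
  -- The dominating function is `C` to the number of arrivals; its integral is finite by the
  -- one-cell grid.
  have hbound : ∫⁻ ω, ∏ j ∈ arrivals fun j => T j ω, (C : ℝ≥0∞) ∂P ≠ ∞ := by
    have := lintegral_prod_arrivals_cellIndex hX hfin hpos one_ne_zero fun _ => C
    rw [this]
    exact ENNReal.ofReal_ne_top
  have hlim : Filter.Tendsto (fun n : ℕ => ∫⁻ ω, ∏ j ∈ arrivals fun j => T j ω,
      (g (cellIndex (n + 1) (T j ω).toNNReal / (n + 1 : ℕ)) : ℝ≥0∞) ∂P) Filter.atTop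
      (nhds (∫⁻ ω, ∏ j ∈ arrivals fun j => T j ω, (g (T j ω).toNNReal : ℝ≥0∞) ∂P)) := by
    refine tendsto_lintegral_of_dominated_convergence _ (fun n => ?_) (fun n => ?_) hbound ?_
    · refine measurable_arrivals_apply hT
        (f := fun S ω => ∏ j ∈ S, (g (cellIndex (n + 1) (T j ω).toNNReal / (n + 1 : ℕ)) : ℝ≥0∞))
        fun S => Finset.measurable_prod _ fun j _ => ?_
      exact (Measurable.of_discrete (f := fun k : ℕ => (g (k / (n + 1 : ℕ)) : ℝ≥0∞))).comp
        ((measurable_cellIndex _).comp (hT j).ennreal_toNNReal)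
    · exact Filter.Eventually.of_forall fun ω => Finset.prod_le_prod' fun j _ => by
        exact_mod_cast hC _
    · refine Filter.Eventually.of_forall fun ω => ?_
      simp_rw [← ENNReal.ofNNReal_finsetProd]
      refine ENNReal.tendsto_coe.2 (tendsto_finsetProd _ fun j _ => ?_)
      exact (hg _).tendsto.comp (tendsto_cellIndex_div _)
  refine tendsto_nhds_unique hlim ?_
  simp_rw [fun n : ℕ => lintegral_prod_arrivals_cellIndex hX hfin hpos n.succ_ne_zero
    fun k => g (k / (n + 1 : ℕ))]
  refine (ENNReal.continuous_ofReal.tendsto _).comp ((Real.continuous_exp.tendsto _).comp ?_)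
  -- The cells cover only `(0, 1]`; the intensity has no atom at `0`.
  have hIcc : ∫ v in Icc 0 1, ((g v : ℝ) - 1) ∂Λ = ∫ v in Ioc 0 1, ((g v : ℝ) - 1) ∂Λ := by
    exact setIntegral_congr_set (Ioc_ae_eq_Icc' hX.intensity_zero).symm
  rw [hIcc]
  simp_rw [fun n : ℕ => sum_cellIndex_eq_setIntegral (Λ := Λ) n.succ_ne_zero
    fun k => (g (k / (n + 1 : ℕ)) : ℝ) - 1]
  have hfinI : Λ (Ioc 0 1) < ∞ :=
    (measure_mono Ioc_subset_Icc_self).trans_lt isCompact_Icc.measure_lt_top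
  refine tendsto_integral_of_dominated_convergence (fun _ => (C : ℝ) + 1) (fun n => ?_)
    (integrableOn_const hfinI.ne) (fun n => ?_) ?_
  · exact ((Measurable.of_discrete (f := fun k : ℕ => (g (k / (n + 1 : ℕ)) : ℝ) - 1)).comp
      (measurable_cellIndex _)).aestronglyMeasurable
  · refine Filter.Eventually.of_forall fun v => ?_
    refine (norm_sub_le _ _).trans ?_
    simpa using hC _
  · refine Filter.Eventually.of_forall fun v => ?_
    exact ((NNReal.continuous_coe.tendsto _).comp
      ((hg v).tendsto.comp (tendsto_cellIndex_div v))).sub_const 1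

/-! ### Jointly measurable evaluation of paths. -/

/-- Evaluation of a path as a limit from the right along grid points. On right-continuous paths this
is the usual evaluation, and it is jointly measurable in the path and the time. -/
noncomputable def rightEval (l : ℝ≥0 → ℝ) (u : ℝ≥0) : ℝ :=
  Filter.limsup (fun n : ℕ => l (⌈((n + 1 : ℕ) : ℝ≥0) * u⌉₊ / (n + 1 : ℕ))) Filter.atTop

theorem measurable_rightEval : Measurable fun p : (ℝ≥0 → ℝ) × ℝ≥0 => rightEval p.1 p.2 := by
  refine Measurable.limsup fun n => ?_
  -- For fixed `n` only countably many times occur, so each numerator can be treated separately.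
  have h1 : Measurable fun q : (ℝ≥0 → ℝ) × ℕ => q.1 ((q.2 : ℝ≥0) / (n + 1 : ℕ)) :=
    measurable_from_prod_countable_left fun k => by
      exact measurable_pi_apply ((k : ℝ≥0) / (n + 1 : ℕ))
  have h2 : Measurable fun p : (ℝ≥0 → ℝ) × ℝ≥0 => ⌈((n + 1 : ℕ) : ℝ≥0) * p.2⌉₊ :=
    Nat.measurable_ceil.comp (measurable_const.mul measurable_snd)
  exact h1.comp (measurable_fst.prodMk h2)

theorem tendsto_ceil_mul_div (u : ℝ≥0) :
    Filter.Tendsto (fun n : ℕ => (⌈((n + 1 : ℕ) : ℝ≥0) * u⌉₊ / (n + 1 : ℕ) : ℝ≥0)) Filter.atTop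
      (nhdsWithin u (Ici u)) := by
  have hpos : ∀ n : ℕ, (0 : ℝ≥0) < (n + 1 : ℕ) := fun n => by positivity
  have hge : ∀ n : ℕ, u ≤ (⌈((n + 1 : ℕ) : ℝ≥0) * u⌉₊ / (n + 1 : ℕ) : ℝ≥0) := by
    intro n
    rw [le_div_iff₀ (hpos n), mul_comm]
    exact Nat.le_ceil _
  refine tendsto_nhdsWithin_iff.2 ⟨?_, Filter.Eventually.of_forall hge⟩
  have hle : ∀ n : ℕ, (⌈((n + 1 : ℕ) : ℝ≥0) * u⌉₊ / (n + 1 : ℕ) : ℝ≥0) ≤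
      u + 1 / ((n : ℝ≥0) + 1) := by
    intro n
    rw [div_le_iff₀ (hpos n)]
    refine (Nat.ceil_lt_add_one zero_le).le.trans (le_of_eq ?_)
    have := (hpos n).ne'
    push_cast at this ⊢
    field_simp
  refine tendsto_of_tendsto_of_tendsto_of_le_of_le tendsto_const_nhds ?_ hge hle
  have h1 : Filter.Tendsto (fun n : ℕ => 1 / ((n : ℝ≥0) + 1)) Filter.atTop (nhds 0) :=
    tendsto_one_div_add_atTop_nhds_zero_nat
  simpa using (tendsto_const_nhds (x := u)).add h1

theorem rightEval_eq {l : ℝ≥0 → ℝ} {u : ℝ≥0} (h : ContinuousWithinAt l (Ici u) u) :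
    rightEval l u = l u :=
  (h.tendsto.comp (tendsto_ceil_mul_div u)).limsup_eq

/-! ### The gain of one cluster and its mean. -/

namespace DelayedCluster

/-- The increment over the window `(t, t + s]` of a cluster with path `l` reported at time `u`. -/
noncomputable def clusterGain (t s u : ℝ≥0) (l : ℝ≥0 → ℝ) : ℝ :=
  rightEval l (t + s - u) - rightEval l (t - u)

/-- The mean increment over the window `(t, t + s]` of a cluster reported at time `u`. -/
noncomputable def meanGain (μ : Measure ℝ≥0) (t s u : ℝ≥0) : ℝ :=
  μ.real (Ioc (t - u) (t + s - u))

theorem measurable_clusterGain (t s : ℝ≥0) :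
    Measurable fun p : ℝ≥0 × (ℝ≥0 → ℝ) => clusterGain t s p.1 p.2 := by
  have h : ∀ x : ℝ≥0, Measurable fun p : ℝ≥0 × (ℝ≥0 → ℝ) => rightEval p.2 (x - p.1) := fun x =>
    measurable_rightEval.comp
      (g := fun q : (ℝ≥0 → ℝ) × ℝ≥0 => rightEval q.1 q.2)
      (f := fun p : ℝ≥0 × (ℝ≥0 → ℝ) => (p.2, x - p.1))
      (measurable_snd.prodMk (measurable_const.sub measurable_fst))
  exact (h (t + s)).sub (h t)

theorem lintegral_exp_clusterGain {Ω : Type*} [MeasurableSpace Ω] {P : Measure Ω}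
    {X : ℝ≥0 → Ω → ℝ} {μ : Measure ℝ≥0} (hX : IsPoissonProcess X μ P) (t s u : ℝ≥0) (θ : ℝ) :
    ∫⁻ ω, ENNReal.ofReal (Real.exp (θ * clusterGain t s u fun v => X v ω)) ∂P =
      ENNReal.ofReal (Real.exp ((Real.exp θ - 1) * meanGain μ t s u)) := by
  have hle : t - u ≤ t + s - u := tsub_le_tsub_right le_self_add u
  rw [meanGain, ← hX.lintegral_exp_increment hle]
  refine lintegral_congr_ae ?_
  filter_upwards [hX.cadlag] with ω hω
  rw [clusterGain, rightEval_eq (hω _).1, rightEval_eq (hω _).1]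

theorem meanGain_nonneg (μ : Measure ℝ≥0) (t s u : ℝ≥0) : 0 ≤ meanGain μ t s u :=
  measureReal_nonneg

theorem measure_Ioc_ne_top {μ : Measure ℝ≥0} [IsLocallyFiniteMeasure μ] (a b : ℝ≥0) :
    μ (Ioc a b) ≠ ∞ :=
  ((measure_mono Ioc_subset_Icc_self).trans_lt isCompact_Icc.measure_lt_top).ne

theorem meanGain_le {μ : Measure ℝ≥0} [IsLocallyFiniteMeasure μ] (t s u : ℝ≥0) :
    meanGain μ t s u ≤ μ.real (Ioc 0 (t + s)) :=
  measureReal_mono (Ioc_subset_Ioc zero_le tsub_le_self) (measure_Ioc_ne_top _ _)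

theorem continuousWithinAt_measureReal_Ioc {μ : Measure ℝ≥0} [IsLocallyFiniteMeasure μ]
    (w : ℝ≥0) : ContinuousWithinAt (fun x => μ.real (Ioc 0 x)) (Ici w) w := by
  rw [continuousWithinAt_Ioi_iff_Ici.symm]
  have h := tendsto_measure_biInter_gt (μ := μ) (s := fun x : ℝ≥0 => Ioc 0 x) (a := w)
    (fun r _ => measurableSet_Ioc.nullMeasurableSet)
    (fun i j _ hij => Ioc_subset_Ioc_right hij)
    ⟨w + 1, lt_add_one w, measure_Ioc_ne_top _ _⟩
  have hI : ⋂ r > w, Ioc 0 r = Ioc 0 w := by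
    ext x
    simp only [mem_iInter, mem_Ioc]
    constructor
    · intro hx
      exact ⟨(hx (w + 1) (lt_add_one w)).1, le_of_forall_gt_imp_ge_of_dense fun r hr => (hx r hr).2⟩
    · exact fun hx r hr => ⟨hx.1, hx.2.trans hr.le⟩
  rw [hI] at h
  exact (ENNReal.tendsto_toReal (measure_Ioc_ne_top 0 w)).comp h

theorem meanGain_eq_sub {μ : Measure ℝ≥0} [IsLocallyFiniteMeasure μ] (t s u : ℝ≥0) :
    meanGain μ t s u = μ.real (Ioc 0 (t + s - u)) - μ.real (Ioc 0 (t - u)) := by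
  have hle : t - u ≤ t + s - u := tsub_le_tsub_right le_self_add u
  rw [meanGain, eq_sub_iff_add_eq', ← measureReal_union _ measurableSet_Ioc
    (measure_Ioc_ne_top _ _) (measure_Ioc_ne_top _ _), Ioc_union_Ioc_eq_Ioc zero_le hle]
  exact Set.disjoint_left.2 fun x h1 h2 => absurd h1.2 (not_le.2 h2.1)

/-- The distribution function `μ(0, x]` is right-continuous, and `u ↦ x - u` reverses order, so
left-continuity results. -/
theorem continuousWithinAt_meanGain {μ : Measure ℝ≥0} [IsLocallyFiniteMeasure μ] (t s u : ℝ≥0) :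
    ContinuousWithinAt (meanGain μ t s) (Iic u) u := by
  have h : ∀ x : ℝ≥0, ContinuousWithinAt (fun u => μ.real (Ioc 0 (x - u))) (Iic u) u := by
    intro x
    refine (continuousWithinAt_measureReal_Ioc (x - u)).comp
      (continuous_const.sub continuous_id).continuousWithinAt ?_
    intro v hv
    exact tsub_le_tsub_left hv x
  exact ((h (t + s)).sub (h t)).congr (fun v _ => meanGain_eq_sub t s v) (meanGain_eq_sub t s u)

theorem measurable_meanGain {μ : Measure ℝ≥0} [IsLocallyFiniteMeasure μ] (t s : ℝ≥0) :
    Measurable (meanGain μ t s) := by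
  have h : ∀ x : ℝ≥0, Measurable fun u => μ.real (Ioc 0 (x - u)) := by
    intro x
    refine Antitone.measurable fun u v huv => ?_
    exact measureReal_mono (Ioc_subset_Ioc_right (tsub_le_tsub_left huv x))
      (measure_Ioc_ne_top _ _)
  rw [show meanGain μ t s = _ from funext fun v => meanGain_eq_sub t s v]
  exact (h (t + s)).sub (h t)

end DelayedCluster

/-! ### Pathwise factorization over arrivals, and mean weights. -/

namespace DelayedCluster

/-- The time at which the `j`-th cluster is reported, on the event that the `j`-th point exists. -/
noncomputable def reportTime {Ω : Type*} (T : ℕ → Ω → ℝ≥0∞) (D : ℕ → Ω → ℝ≥0) (j : ℕ) (ω : Ω) :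
    ℝ≥0 :=
  (T j ω).toNNReal + D j ω

section Pathwise

variable {Ω : Type*} {T : ℕ → Ω → ℝ≥0∞} {D : ℕ → Ω → ℝ≥0} {L : ℕ → ℝ≥0 → Ω → ℝ} {ω : Ω}

theorem reportedCount_eq_card (h : {j | T j ω ≤ 1}.Finite) (t : ℝ≥0) :
    reportedCount T D t ω =
      ((arrivals fun j => T j ω).filter fun j => reportTime T D j ω ≤ t).card := by
  rw [reportedCount, ← Set.ncard_coe_finset]
  congr 1
  ext j
  simp only [mem_ofPred_eq, Finset.coe_filter, mem_arrivals h]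
  rw [and_comm]
  refine and_congr_right fun hj => ?_
  rw [← ENNReal.coe_le_coe, reportTime, ENNReal.coe_add,
    ENNReal.coe_toNNReal (ne_top_of_le_ne_top ENNReal.one_ne_top hj)]

theorem clusterProcess_eq_sum (h : {j | T j ω ≤ 1}.Finite) (t : ℝ≥0) :
    clusterProcess T D L t ω =
      ∑ j ∈ arrivals fun j => T j ω, L j (t - reportTime T D j ω) ω := by
  rw [clusterProcess, tsum_eq_sum (s := arrivals fun j => T j ω)]
  · exact Finset.sum_congr rfl fun j hj => if_pos (le_one_of_mem_arrivals hj)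
  · exact fun j hj => if_neg fun hle => hj ((mem_arrivals h).2 hle)

/-- Right-continuity lets `rightEval` replace evaluation, giving jointly measurable functions of
report time and path. -/
theorem increment_eq_sum (h : {j | T j ω ≤ 1}.Finite)
    (hL : ∀ j u, ContinuousWithinAt (fun v => L j v ω) (Ici u) u) (t s : ℝ≥0) :
    increment T D L t s ω =
      ∑ j ∈ arrivals fun j => T j ω,
        clusterGain t s (reportTime T D j ω) fun u => L j u ω := by
  rw [increment, clusterProcess_eq_sum h, clusterProcess_eq_sum h, ← Finset.sum_sub_distrib]
  refine Finset.sum_congr rfl fun j _ => ?_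
  rw [clusterGain, rightEval_eq (hL j _), rightEval_eq (hL j _)]

end Pathwise

/-- The contribution of one cluster to the joint transform of the reported count and the
increment. -/
noncomputable def clusterWeight (t s z : ℝ≥0) (θ : ℝ) (u : ℝ≥0) (l : ℝ≥0 → ℝ) : ℝ≥0∞ :=
  (if u ≤ t then (z : ℝ≥0∞) else 1) * ENNReal.ofReal (Real.exp (θ * clusterGain t s u l))

/-- The mean of `clusterWeight`. -/
noncomputable def meanWeight (μ : Measure ℝ≥0) (t s z : ℝ≥0) (θ : ℝ) (u : ℝ≥0) : ℝ≥0 :=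
  (if u ≤ t then z else 1) * (Real.exp ((Real.exp θ - 1) * meanGain μ t s u)).toNNReal

theorem pow_reportedCount_mul_exp_increment {Ω : Type*} {T : ℕ → Ω → ℝ≥0∞} {D : ℕ → Ω → ℝ≥0}
    {L : ℕ → ℝ≥0 → Ω → ℝ} {ω : Ω} (h : {j | T j ω ≤ 1}.Finite)
    (hL : ∀ j u, ContinuousWithinAt (fun v => L j v ω) (Ici u) u) (t s z : ℝ≥0) (θ : ℝ) :
    (z : ℝ≥0∞) ^ reportedCount T D t ω *
        ENNReal.ofReal (Real.exp (θ * increment T D L t s ω)) =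
      ∏ j ∈ arrivals fun j => T j ω,
        clusterWeight t s z θ (reportTime T D j ω) fun u => L j u ω := by
  simp only [clusterWeight]
  rw [Finset.prod_mul_distrib, reportedCount_eq_card h, increment_eq_sum h hL, Finset.mul_sum,
    Real.exp_sum, ENNReal.ofReal_prod_of_nonneg fun i _ => (Real.exp_pos _).le,
    ← Finset.prod_filter, Finset.prod_const]

theorem measurable_clusterWeight (t s z : ℝ≥0) (θ : ℝ) :
    Measurable fun p : ℝ≥0 × (ℝ≥0 → ℝ) => clusterWeight t s z θ p.1 p.2 := by
  refine Measurable.mul ?_ ?_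
  · exact Measurable.ite (measurableSet_le measurable_fst measurable_const) measurable_const
      measurable_const
  · exact ((measurable_clusterGain t s).const_mul θ).exp.ennreal_ofReal

theorem lintegral_clusterWeight {Ω : Type*} [MeasurableSpace Ω] {P : Measure Ω}
    {X : ℝ≥0 → Ω → ℝ} {μ : Measure ℝ≥0} (hX : IsPoissonProcess X μ P) (t s z : ℝ≥0) (θ : ℝ)
    (u : ℝ≥0) :
    ∫⁻ ω, clusterWeight t s z θ u (fun v => X v ω) ∂P = meanWeight μ t s z θ u := by
  simp only [clusterWeight]
  rw [lintegral_const_mul', lintegral_exp_clusterGain hX, meanWeight]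
  · split_ifs <;> simp [ENNReal.ofReal]
  · split_ifs <;> simp

section MeanWeight

variable {μ : Measure ℝ≥0} [IsLocallyFiniteMeasure μ]

theorem measurable_meanWeight (t s z : ℝ≥0) (θ : ℝ) : Measurable (meanWeight μ t s z θ) := by
  refine Measurable.mul ?_ ?_
  · exact Measurable.ite measurableSet_Iic measurable_const measurable_const
  · exact ((measurable_meanGain t s).const_mul _).exp.real_toNNReal

theorem continuousWithinAt_meanWeight (t s z : ℝ≥0) (θ : ℝ) (u : ℝ≥0) :
    ContinuousWithinAt (meanWeight μ t s z θ) (Iic u) u := by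
  refine ContinuousWithinAt.mul ?_ ?_
  · rcases le_or_gt u t with h | h
    · refine (continuousWithinAt_const (b := z)).congr (fun v hv => ?_) ?_
      · simp [le_trans (show v ≤ u from hv) h]
      · simp [h]
    · refine ContinuousWithinAt.congr_of_eventuallyEq (f := fun _ => (1 : ℝ≥0))
        continuousWithinAt_const ?_ ?_
      · filter_upwards [nhdsWithin_le_nhds (Ioi_mem_nhds h)] with v hv
        exact if_neg (not_le.2 hv)
      · exact if_neg (not_le.2 h)
  · refine (continuous_real_toNNReal.comp Real.continuous_exp).continuousAt.comp_continuousWithinAt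
      ((continuousWithinAt_meanGain t s u).const_mul _)

theorem exp_mul_meanGain_le (t s : ℝ≥0) (c : ℝ) (u : ℝ≥0) :
    Real.exp (c * meanGain μ t s u) ≤ Real.exp (|c| * μ.real (Ioc 0 (t + s))) := by
  refine Real.exp_le_exp.2 ?_
  refine mul_le_mul (le_abs_self c) (meanGain_le t s u) (meanGain_nonneg _ _ _ _) (abs_nonneg c)

theorem exists_meanWeight_le (t s z : ℝ≥0) (θ : ℝ) : ∃ C : ℝ≥0, ∀ u, meanWeight μ t s z θ u ≤ C := by
  refine ⟨max z 1 * (Real.exp (|Real.exp θ - 1| * μ.real (Ioc 0 (t + s)))).toNNReal, fun u => ?_⟩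
  refine mul_le_mul' ?_ (Real.toNNReal_le_toNNReal (exp_mul_meanGain_le t s _ u))
  split_ifs
  · exact le_max_left _ _
  · exact le_max_right _ _

end MeanWeight

/-- Integrating out an independent delay preserves left-continuity. -/
theorem exists_delayed_mean {F : Measure ℝ≥0} [IsProbabilityMeasure F] {γ : ℝ≥0 → ℝ≥0}
    (hγm : Measurable γ) (hγ : ∀ u, ContinuousWithinAt γ (Iic u) u) {C : ℝ≥0} (hC : ∀ u, γ u ≤ C) :
    ∃ g : ℝ≥0 → ℝ≥0, (∀ v, (g v : ℝ≥0∞) = ∫⁻ r, (γ (v + r) : ℝ≥0∞) ∂F) ∧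
      (∀ v, ContinuousWithinAt g (Iic v) v) ∧ ∀ v, g v ≤ C := by
  have hle : ∀ v, ∫⁻ r, (γ (v + r) : ℝ≥0∞) ∂F ≤ C := by
    intro v
    refine (lintegral_mono (g := fun _ => (C : ℝ≥0∞)) fun r => ?_).trans (by simp)
    exact ENNReal.coe_le_coe.2 (hC _)
  have hg : ∀ v, ((∫⁻ r, (γ (v + r) : ℝ≥0∞) ∂F).toNNReal : ℝ≥0∞) =
      ∫⁻ r, (γ (v + r) : ℝ≥0∞) ∂F := fun v =>
    ENNReal.coe_toNNReal (ne_top_of_le_ne_top ENNReal.coe_ne_top (hle v))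
  refine ⟨fun v => (∫⁻ r, (γ (v + r) : ℝ≥0∞) ∂F).toNNReal, hg, fun v => ?_, fun v => ?_⟩
  · rw [ContinuousWithinAt, ← ENNReal.tendsto_coe]
    simp_rw [hg]
    refine tendsto_lintegral_filter_of_dominated_convergence (fun _ => (C : ℝ≥0∞)) ?_ ?_ ?_ ?_
    · exact Filter.Eventually.of_forall fun w =>
        (hγm.comp (measurable_const.add measurable_id)).coe_nnreal_ennreal
    · exact Filter.Eventually.of_forall fun w => Filter.Eventually.of_forall fun r => by
        exact_mod_cast hC _
    · simp
    · refine Filter.Eventually.of_forall fun r => ENNReal.tendsto_coe.2 ?_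
      refine (hγ (v + r)).tendsto.comp (tendsto_nhdsWithin_iff.2 ⟨?_, ?_⟩)
      · exact ((continuous_id.add continuous_const).tendsto v).mono_left nhdsWithin_le_nhds
      · filter_upwards [self_mem_nhdsWithin] with w hw
        exact add_le_add_left (show w ≤ v from hw) r
  · rw [← ENNReal.coe_le_coe, hg]
    exact hle v

/-! ### The joint transform of count and increment. -/

section Model

variable {Ω : Type*} [MeasurableSpace Ω] {P : Measure Ω}
  {T : ℕ → Ω → ℝ≥0∞} {D : ℕ → Ω → ℝ≥0} {L : ℕ → ℝ≥0 → Ω → ℝ} {Λ F_D μ : Measure ℝ≥0}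

theorem IsModel.ae_finite (h : IsModel P T D L Λ F_D μ) : ∀ᵐ ω ∂P, {j | T j ω ≤ 1}.Finite := by
  filter_upwards [h.T_finite] with ω hω
  simpa using hω 1

theorem IsModel.ae_pos (h : IsModel P T D L Λ F_D μ) : ∀ᵐ ω ∂P, ∀ j, 0 < T j ω := by
  filter_upwards [h.T_pos, h.T_strict] with ω h0 hω j
  exact h0.trans_le (monotone_nat_of_le_succ (fun j => (hω j).1) (Nat.zero_le j))

theorem IsModel.ae_rightContinuous (h : IsModel P T D L Λ F_D μ) :
    ∀ᵐ ω ∂P, ∀ j u, ContinuousWithinAt (fun v => L j v ω) (Ici u) u := by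
  filter_upwards [ae_all_iff.2 fun j => (h.poisson_clusters j).cadlag] with ω hω j u
  exact (hω j u).1

theorem IsModel.isProbabilityMeasure_delay [IsProbabilityMeasure P] (h : IsModel P T D L Λ F_D μ) :
    IsProbabilityMeasure F_D := by
  rw [← h.law_D 0]
  exact Measure.isProbabilityMeasure_map (h.measurable_D 0).aemeasurable

theorem IsModel.measurable_cluster (h : IsModel P T D L Λ F_D μ) (j : ℕ) :
    Measurable fun ω u => L j u ω :=
  measurable_pi_lambda _ fun u => (h.poisson_clusters j).measurable u

/-- Delays and clusters can be integrated out separately for each point. -/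
theorem IsModel.lintegral_prod_marks [IsProbabilityMeasure P] (h : IsModel P T D L Λ F_D μ)
    {k : ℝ≥0 → (ℝ≥0 → ℝ) → ℝ≥0∞} (hk : Measurable fun p : ℝ≥0 × (ℝ≥0 → ℝ) => k p.1 p.2)
    {γ : ℝ≥0 → ℝ≥0∞} (hγ : ∀ j u, ∫⁻ ω, k u (fun v => L j v ω) ∂P = γ u) :
    ∫⁻ ω, ∏ j ∈ arrivals fun j => T j ω, k (reportTime T D j ω) (fun u => L j u ω) ∂P =
      ∫⁻ ω, ∏ j ∈ arrivals fun j => T j ω, ∫⁻ r, γ ((T j ω).toNNReal + r) ∂F_D ∂P := by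
  have := h.isProbabilityMeasure_delay
  have hT : Measurable fun ω j => T j ω := measurable_pi_lambda _ h.measurable_T
  have hL : Measurable fun ω j u => L j u ω := measurable_pi_lambda _ h.measurable_cluster
  have hγm : Measurable γ := by
    have h1 : γ = fun u => ∫⁻ l, k u l ∂(P.map fun ω u => L 0 u ω) := by
      funext u
      rw [← hγ 0 u, lintegral_map (by exact hk.comp measurable_prodMk_left)
        (h.measurable_cluster 0)]
    have : IsProbabilityMeasure (P.map fun ω u => L 0 u ω) :=
      Measure.isProbabilityMeasure_map (h.measurable_cluster 0).aemeasurable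
    rw [h1]
    exact hk.lintegral_prod_right'
  rw [lintegral_arrivals_apply h.measurable_T
      (f := fun S ω => ∏ j ∈ S, k (reportTime T D j ω) (fun u => L j u ω)),
    lintegral_arrivals_apply h.measurable_T
      (f := fun S ω => ∏ j ∈ S, ∫⁻ r, γ ((T j ω).toNNReal + r) ∂F_D)]
  -- For a fixed index set, the delays are integrated with `(T, L)` frozen (`h1`), then the clusters
  -- with `T` frozen (`h2`).
  · refine tsum_congr fun S => ?_
    have hA : Measurable ({τ : ℕ → ℝ≥0∞ | arrivals τ = S}.indicator
        (1 : (ℕ → ℝ≥0∞) → ℝ≥0∞)) := measurable_one.indicator (measurableSet_arrivals_eq S)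
    have hkD : ∀ j, Measurable fun p : ((ℕ → ℝ≥0∞) × (ℕ → ℝ≥0 → ℝ)) × ℝ≥0 =>
        k ((p.1.1 j).toNNReal + p.2) (p.1.2 j) := fun j => by
      refine hk.comp (Measurable.prodMk (Measurable.add ?_ measurable_snd) ?_)
      · exact ((measurable_pi_apply j).comp (measurable_fst.comp measurable_fst)).ennreal_toNNReal
      · exact (measurable_pi_apply j).comp (measurable_snd.comp measurable_fst)
    have h1 := lintegral_mul_prod_of_indepFun
      (X := fun ω => ((fun j => T j ω : ℕ → ℝ≥0∞), (fun j u => L j u ω : ℕ → ℝ≥0 → ℝ)))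
      (Y := D) (hT.prodMk hL) h.measurable_D h.indep_D_TL.symm h.indep_D
      (f := fun p => {τ : ℕ → ℝ≥0∞ | arrivals τ = S}.indicator 1 p.1) (hA.comp measurable_fst)
      (k := fun j p d => k ((p.1 j).toNNReal + d) (p.2 j)) hkD S
    simp only [h.law_D] at h1
    have hkL : ∀ j, Measurable fun p : (ℕ → ℝ≥0∞) × (ℝ≥0 → ℝ) =>
        ∫⁻ r, k ((p.1 j).toNNReal + r) p.2 ∂F_D := fun j => by
      refine Measurable.lintegral_prod_right' (f := fun q : ((ℕ → ℝ≥0∞) × (ℝ≥0 → ℝ)) × ℝ≥0 =>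
        k ((q.1.1 j).toNNReal + q.2) q.1.2) ?_
      refine hk.comp (Measurable.prodMk (Measurable.add ?_ measurable_snd) ?_)
      · exact ((measurable_pi_apply j).comp (measurable_fst.comp measurable_fst)).ennreal_toNNReal
      · exact measurable_snd.comp measurable_fst
    have h2 := lintegral_mul_prod_of_indepFun (X := fun ω j => T j ω)
      (Y := fun j ω u => L j u ω) hT h.measurable_cluster h.indep_T_L h.indep_L hA
      (k := fun j τ l => ∫⁻ r, k ((τ j).toNNReal + r) l ∂F_D) hkL S
    refine h1.trans (h2.trans (lintegral_congr fun ω => ?_))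
    congr 1
    refine Finset.prod_congr rfl fun j _ => ?_
    rw [lintegral_map (by exact (hkL j).comp (measurable_prodMk_left (x := fun j => T j ω))) (h.measurable_cluster j),
      lintegral_lintegral_swap]
    · exact lintegral_congr fun r => hγ j _
    · refine (hk.comp (Measurable.prodMk ?_ ?_)).aemeasurable
      · exact measurable_const.add measurable_snd
      · exact (h.measurable_cluster j).comp measurable_fst
  · refine fun S => Finset.measurable_prod _ fun j _ => ?_
    refine Measurable.comp (g := fun v => ∫⁻ r, γ (v + r) ∂F_D) ?_
      (h.measurable_T j).ennreal_toNNReal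
    exact Measurable.lintegral_prod_right' (f := fun p : ℝ≥0 × ℝ≥0 => γ (p.1 + p.2))
      (hγm.comp (measurable_fst.add measurable_snd))
  · refine fun S => Finset.measurable_prod _ fun j _ => ?_
    exact hk.comp (((h.measurable_T j).ennreal_toNNReal.add (h.measurable_D j)).prodMk
      (h.measurable_cluster j))

/-- The measure `Λ ∗ F_D`, with `Λ` restricted to the arrival window. -/
noncomputable def reportMeasure (Λ F_D : Measure ℝ≥0) : Measure ℝ≥0 :=
  Measure.conv (Λ.restrict (Icc 0 1)) F_D

theorem IsModel.isFiniteMeasure_restrict (h : IsModel P T D L Λ F_D μ) :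
    IsFiniteMeasure (Λ.restrict (Icc 0 1)) := by
  have := h.poisson_centers.isLocallyFiniteMeasure
  exact ⟨by rw [Measure.restrict_apply_univ]; exact isCompact_Icc.measure_lt_top⟩

theorem IsModel.isFiniteMeasure_reportMeasure [IsProbabilityMeasure P] (h : IsModel P T D L Λ F_D μ) :
    IsFiniteMeasure (reportMeasure Λ F_D) := by
  have := h.isFiniteMeasure_restrict
  have := h.isProbabilityMeasure_delay
  unfold reportMeasure
  infer_instance

theorem IsModel.isLocallyFiniteMeasure_cluster (h : IsModel P T D L Λ F_D μ) :
    IsLocallyFiniteMeasure μ :=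
  (h.poisson_clusters 0).isLocallyFiniteMeasure

theorem integrable_exp_mul_meanGain {K : Measure ℝ≥0} [IsFiniteMeasure K]
    [IsLocallyFiniteMeasure μ] (t s : ℝ≥0) (c : ℝ) :
    Integrable (fun u => Real.exp (c * meanGain μ t s u)) K := by
  refine Integrable.of_bound ((measurable_meanGain t s).const_mul c).exp.aestronglyMeasurable
    (Real.exp (|c| * μ.real (Ioc 0 (t + s)))) (Filter.Eventually.of_forall fun u => ?_)
  rw [Real.norm_of_nonneg (Real.exp_pos _).le]
  exact exp_mul_meanGain_le t s c u

/-- The joint transform of the reported count and the increment. -/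
theorem IsModel.lintegral_pow_mul_exp [IsProbabilityMeasure P] (h : IsModel P T D L Λ F_D μ) (t s z : ℝ≥0) (θ : ℝ) :
    ∫⁻ ω, (z : ℝ≥0∞) ^ reportedCount T D t ω *
        ENNReal.ofReal (Real.exp (θ * increment T D L t s ω)) ∂P =
      ENNReal.ofReal (Real.exp
        (z * mgf (meanGain μ t s) ((reportMeasure Λ F_D).restrict (Iic t)) (Real.exp θ - 1) +
        (mgf (meanGain μ t s) ((reportMeasure Λ F_D).restrict (Ioi t)) (Real.exp θ - 1) -
          Λ.real (Icc 0 1)))) := by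
  have := h.isFiniteMeasure_restrict
  have := h.isProbabilityMeasure_delay
  have := h.isFiniteMeasure_reportMeasure
  have := h.isLocallyFiniteMeasure_cluster
  obtain ⟨C, hC⟩ := exists_meanWeight_le (μ := μ) t s z θ
  obtain ⟨g, hg, hgc, hgC⟩ := exists_delayed_mean (F := F_D) (measurable_meanWeight (μ := μ) t s z θ)
    (continuousWithinAt_meanWeight t s z θ) hC
  rw [lintegral_congr_ae (by
    filter_upwards [h.ae_finite, h.ae_rightContinuous] with ω h1 h2
    exact pow_reportedCount_mul_exp_increment h1 h2 t s z θ),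
    h.lintegral_prod_marks (measurable_clusterWeight t s z θ)
      (γ := fun u => (meanWeight μ t s z θ u : ℝ≥0∞))
      fun j u => lintegral_clusterWeight (h.poisson_clusters j) t s z θ u]
  simp_rw [← hg]
  rw [lintegral_prod_arrivals h.measurable_T h.poisson_centers h.ae_finite h.ae_pos hgc hgC]
  congr 2
  have hgm : Measurable g := by
    have : Measurable fun v => ∫⁻ r, (meanWeight μ t s z θ (v + r) : ℝ≥0∞) ∂F_D :=
      Measurable.lintegral_prod_right'
        (f := fun p : ℝ≥0 × ℝ≥0 => (meanWeight μ t s z θ (p.1 + p.2) : ℝ≥0∞))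
        ((measurable_meanWeight t s z θ).comp (measurable_fst.add measurable_snd)).coe_nnreal_ennreal
    simp_rw [← hg] at this
    simpa using this.ennreal_toNNReal
  have hgi : Integrable (fun v => (g v : ℝ)) (Λ.restrict (Icc 0 1)) := by
    refine Integrable.of_bound hgm.coe_nnreal_real.aestronglyMeasurable C
      (Filter.Eventually.of_forall fun v => ?_)
    simpa using hgC v
  rw [integral_sub hgi (integrable_const 1)]
  have hK : ∫ v in Icc 0 1, (g v : ℝ) ∂Λ =
      ∫ u, (meanWeight μ t s z θ u : ℝ) ∂(reportMeasure Λ F_D) := by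
    rw [integral_eq_lintegral_of_nonneg_ae (Filter.Eventually.of_forall fun v => NNReal.coe_nonneg (g v))
      hgm.coe_nnreal_real.aestronglyMeasurable,
      integral_eq_lintegral_of_nonneg_ae (Filter.Eventually.of_forall fun v => NNReal.coe_nonneg _)
      (measurable_meanWeight t s z θ).coe_nnreal_real.aestronglyMeasurable]
    simp only [ENNReal.ofReal_coe_nnreal]
    rw [reportMeasure, Measure.lintegral_conv
      (measurable_meanWeight t s z θ).coe_nnreal_ennreal]
    simp_rw [hg]
  have hwi : Integrable (fun u => (meanWeight μ t s z θ u : ℝ)) (reportMeasure Λ F_D) := by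
    refine Integrable.of_bound (measurable_meanWeight t s z θ).coe_nnreal_real.aestronglyMeasurable
      C (Filter.Eventually.of_forall fun v => ?_)
    simpa using hC v
  -- Splitting at `t` isolates `z`, which multiplies exactly the reported part.
  rw [hK, ← integral_add_compl (measurableSet_Iic (a := t)) hwi, compl_Iic,
    setIntegral_congr_fun (g := fun u => z * Real.exp ((Real.exp θ - 1) * meanGain μ t s u))
      measurableSet_Iic,
    setIntegral_congr_fun (g := fun u => Real.exp ((Real.exp θ - 1) * meanGain μ t s u))
      measurableSet_Ioi, integral_const_mul]
  · simp [mgf, add_sub_assoc]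
  · intro u hu
    simp [meanWeight, not_le.2 (show t < u from hu), (Real.exp_pos _).le]
  · intro u hu
    simp [meanWeight, show u ≤ t from hu, (Real.exp_pos _).le]

end Model

end DelayedCluster

/-! ### Auxiliary facts on cardinality, Poisson means and derivatives. -/

theorem measurable_ncard_nat : Measurable fun s : Set ℕ => s.ncard := by
  refine measurable_to_countable' fun n => measurableSet_setOf_set_nat ?_
  rcases eq_or_ne n 0 with rfl | hn
  · right
    intro s hs
    by_contra hfin
    exact hs (Set.Infinite.ncard hfin)
  · left
    intro s hs
    by_contra hfin
    exact hn (hs.symm.trans (Set.Infinite.ncard hfin))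

theorem hasSum_poisson_mean (r : ℝ) :
    HasSum (fun n : ℕ => Real.exp (-r) * (r ^ n / n.factorial) * n) r := by
  rw [← hasSum_nat_add_iff' 1]
  simp only [Finset.range_one, Finset.sum_singleton, Nat.cast_zero, mul_zero, sub_zero]
  have h := (NormedSpace.expSeries_div_hasSum_exp r).mul_left (Real.exp (-r) * r)
  rw [← Real.exp_eq_exp_ℝ, mul_right_comm, ← Real.exp_add, neg_add_cancel, Real.exp_zero,
    one_mul] at h
  refine h.congr_fun fun n => ?_
  rw [Nat.factorial_succ]
  have h1 : ((n : ℝ) + 1) ≠ 0 := by positivity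
  have h2 : (n.factorial : ℝ) ≠ 0 := by positivity
  push_cast
  field_simp
  ring

theorem deriv_comp_exp_sub_one_add_const {φ : ℝ → ℝ}
    (hφ : ∀ x, AnalyticAt ℝ φ x) (c : ℝ) :
    deriv (fun x => φ (Real.exp x - 1) + c) =
      fun x => deriv φ (Real.exp x - 1) * Real.exp x := by
  funext x
  exact (((hφ _).differentiableAt.hasDerivAt.comp x
    ((Real.hasDerivAt_exp x).sub_const 1)).add_const c).deriv

theorem deriv_comp_exp_sub_one_add_const_zero {φ : ℝ → ℝ}
    (hφ : ∀ x, AnalyticAt ℝ φ x) (c : ℝ) :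
    deriv (fun x => φ (Real.exp x - 1) + c) 0 = deriv φ 0 := by
  simp [deriv_comp_exp_sub_one_add_const hφ]

/-- The chain rule gives `φ'' e^{2x} + φ' e^x`; the extra `φ'` reflects the Poisson noise inside the
clusters. -/
theorem iteratedDeriv_two_comp_exp_sub_one_add_const_zero {φ : ℝ → ℝ}
    (hφ : ∀ x, AnalyticAt ℝ φ x) (c : ℝ) :
    iteratedDeriv 2 (fun x => φ (Real.exp x - 1) + c) 0 = iteratedDeriv 2 φ 0 + deriv φ 0 := by
  rw [iteratedDeriv_succ, iteratedDeriv_one, deriv_comp_exp_sub_one_add_const hφ,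
    iteratedDeriv_succ, iteratedDeriv_one]
  have h := (((hφ _).deriv.differentiableAt.hasDerivAt.comp (0 : ℝ)
    ((Real.hasDerivAt_exp 0).sub_const 1)).mul (Real.hasDerivAt_exp 0)).deriv
  simp only [Real.exp_zero, sub_self, mul_one, Function.comp_apply] at h
  exact h

/-! ### The law of the reported count. -/

namespace DelayedCluster

theorem integrableExpSet_meanGain {K μ : Measure ℝ≥0} [IsFiniteMeasure K]
    [IsLocallyFiniteMeasure μ] (t s : ℝ≥0) : integrableExpSet (meanGain μ t s) K = univ :=
  eq_univ_of_forall fun c => integrable_exp_mul_meanGain t s c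

section Model

variable {Ω : Type*} [MeasurableSpace Ω] {P : Measure Ω}
  {T : ℕ → Ω → ℝ≥0∞} {D : ℕ → Ω → ℝ≥0} {L : ℕ → ℝ≥0 → Ω → ℝ} {Λ F_D μ : Measure ℝ≥0}

theorem IsModel.measurable_reportedCount (h : IsModel P T D L Λ F_D μ) (t : ℝ≥0) :
    Measurable (reportedCount T D t) := by
  refine measurable_ncard_nat.comp (measurable_set_iff.2 fun j => ?_)
  have h1 : MeasurableSet {ω | T j ω + (D j ω : ℝ≥0∞) ≤ t} :=
    measurableSet_le ((h.measurable_T j).add (h.measurable_D j).coe_nnreal_ennreal)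
      measurable_const
  have h2 : MeasurableSet {ω | T j ω ≤ 1} := measurableSet_le (h.measurable_T j) measurable_const
  exact (h1.inter h2).mem

theorem IsModel.aemeasurable_increment (h : IsModel P T D L Λ F_D μ) (t s : ℝ≥0) :
    AEMeasurable (increment T D L t s) P := by
  refine ⟨fun ω => ∑ j ∈ arrivals fun j => T j ω,
    clusterGain t s (reportTime T D j ω) fun u => L j u ω, ?_, ?_⟩
  · refine measurable_arrivals_apply h.measurable_T
      (f := fun S ω => ∑ j ∈ S, clusterGain t s (reportTime T D j ω) fun u => L j u ω)
      fun S => Finset.measurable_sum _ fun j _ => ?_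
    exact Measurable.comp (g := fun p : ℝ≥0 × (ℝ≥0 → ℝ) => clusterGain t s p.1 p.2)
      (f := fun ω => (reportTime T D j ω, fun u => L j u ω)) (measurable_clusterGain t s)
      (((h.measurable_T j).ennreal_toNNReal.add (h.measurable_D j)).prodMk
        (h.measurable_cluster j))
  · filter_upwards [h.ae_finite, h.ae_rightContinuous] with ω h1 h2
    exact increment_eq_sum h1 h2 t s

theorem IsModel.aemeasurable_increment_condReported {t s : ℝ≥0} {ℓ : ℕ}
    (h : IsModel P T D L Λ F_D μ) :
    AEMeasurable (increment T D L t s) (condReported P T D t ℓ) :=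
  (h.aemeasurable_increment t s).mono_ac cond_absolutelyContinuous

variable [IsProbabilityMeasure P]

/-- The transform of the increment on the event that `n` clusters are reported. -/
theorem IsModel.setLIntegral_exp_increment (h : IsModel P T D L Λ F_D μ) (t s : ℝ≥0) (θ : ℝ)
    (n : ℕ) :
    ∫⁻ ω in {ω | reportedCount T D t ω = n},
        ENNReal.ofReal (Real.exp (θ * increment T D L t s ω)) ∂P =
      ENNReal.ofReal (Real.exp
        (mgf (meanGain μ t s) ((reportMeasure Λ F_D).restrict (Ioi t)) (Real.exp θ - 1) -
          Λ.real (Icc 0 1)) *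
        (mgf (meanGain μ t s) ((reportMeasure Λ F_D).restrict (Iic t)) (Real.exp θ - 1) ^ n /
          n.factorial)) := by
  refine eq_of_tsum_pow_eq_exp (p := fun n => ∫⁻ ω in {ω | reportedCount T D t ω = n},
    ENNReal.ofReal (Real.exp (θ * increment T D L t s ω)) ∂P) mgf_nonneg (fun z => ?_) n
  rw [← h.lintegral_pow_mul_exp t s z θ]
  have hU : ⋃ n, {ω | reportedCount T D t ω = n} = univ := by
    ext ω
    simp
  have hm : ∀ n, MeasurableSet {ω | reportedCount T D t ω = n} := fun n =>
    h.measurable_reportedCount t (measurableSet_singleton n)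
  rw [← setLIntegral_univ, ← hU, lintegral_iUnion hm]
  · refine tsum_congr fun n => ?_
    rw [← lintegral_const_mul' _ _ (by simp)]
    refine setLIntegral_congr_fun (hm n) fun ω hω => ?_
    simp only [mem_ofPred_eq] at hω
    simp only [hω]
  · intro i j hij
    exact Set.disjoint_left.2 fun ω h1 h2 => hij (h1.symm.trans h2)

theorem IsModel.measure_reportedCount_eq (h : IsModel P T D L Λ F_D μ) (t : ℝ≥0) (n : ℕ) :
    P {ω | reportedCount T D t ω = n} = ENNReal.ofReal (Real.exp
        ((reportMeasure Λ F_D).real (Ioi t) - Λ.real (Icc 0 1)) *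
        ((reportMeasure Λ F_D).real (Iic t) ^ n / n.factorial)) := by
  -- At `θ = 0` the integrand is `1`, so the window length is immaterial.
  simpa using h.setLIntegral_exp_increment t 0 0 n

/-- At `z = 1`, `θ = 0` the joint transform is the total probability `1`, so its exponent vanishes.
-/
theorem IsModel.reportMeasure_real_sub (h : IsModel P T D L Λ F_D μ) (t : ℝ≥0) :
    (reportMeasure Λ F_D).real (Ioi t) - Λ.real (Icc 0 1) = -(reportMeasure Λ F_D).real (Iic t) := by
  have h1 := h.lintegral_pow_mul_exp t 0 1 0
  simp only [ENNReal.coe_one, one_pow, zero_mul, Real.exp_zero, ENNReal.ofReal_one, mul_one,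
    lintegral_const, measure_univ, NNReal.coe_one, one_mul, sub_self, mgf_zero',
    measureReal_restrict_apply_univ] at h1
  have h2 := congrArg ENNReal.toReal h1
  rw [ENNReal.toReal_ofReal (Real.exp_pos _).le, ENNReal.toReal_one, eq_comm,
    Real.exp_eq_one_iff] at h2
  linarith

/-- The number of reported clusters has a Poisson distribution. -/
theorem IsModel.map_reportedCount (h : IsModel P T D L Λ F_D μ) (t : ℝ≥0) :
    P.map (reportedCount T D t) =
      poissonMeasure ((reportMeasure Λ F_D).real (Iic t)).toNNReal := by
  refine Measure.ext_of_singleton fun n => ?_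
  rw [Measure.map_apply (h.measurable_reportedCount t) (measurableSet_singleton n),
    poissonMeasure_singleton, Real.coe_toNNReal _ measureReal_nonneg]
  refine (h.measure_reportedCount_eq t n).trans ?_
  rw [h.reportMeasure_real_sub, mul_div_assoc]

theorem IsModel.integrable_reportedCount (h : IsModel P T D L Λ F_D μ) (t : ℝ≥0) :
    Integrable (fun ω => (reportedCount T D t ω : ℝ)) P := by
  have h1 : Integrable (fun n : ℕ => (n : ℝ)) (P.map (reportedCount T D t)) := by
    rw [h.map_reportedCount, integrable_poissonMeasure_iff,
      Real.coe_toNNReal _ measureReal_nonneg]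
    refine (hasSum_poisson_mean ((reportMeasure Λ F_D).real (Iic t))).summable.congr fun n => ?_
    simp [mul_div_assoc]
  exact h1.comp_measurable (h.measurable_reportedCount t)

theorem IsModel.meanReported_eq (h : IsModel P T D L Λ F_D μ) (t : ℝ≥0) :
    meanReported P T D t = (reportMeasure Λ F_D).real (Iic t) := by
  rw [meanReported, ← integral_map (f := fun n : ℕ => (n : ℝ))
    (h.measurable_reportedCount t).aemeasurable (by fun_prop), h.map_reportedCount,
    integral_poissonMeasure, Real.coe_toNNReal _ measureReal_nonneg]
  refine HasSum.tsum_eq ?_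
  simpa [mul_div_assoc] using hasSum_poisson_mean ((reportMeasure Λ F_D).real (Iic t))

/-! ### Conditional transform, mean and variance. -/

section Conditional

variable {t s : ℝ≥0} {ℓ : ℕ}

/-- Dividing the transform on the event by the event's probability cancels `Λ[0,1]` and `ℓ!`. If the
reported mass is `0`, then `ℓ = 0` and the power of the quotient is `1`. -/
theorem IsModel.lintegral_exp_increment_condReported (h : IsModel P T D L Λ F_D μ)
    (hℓ : P {ω | reportedCount T D t ω = ℓ} ≠ 0) (θ : ℝ) :
    ∫⁻ ω, ENNReal.ofReal (Real.exp (θ * increment T D L t s ω)) ∂(condReported P T D t ℓ) =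
      ENNReal.ofReal (Real.exp
        (mgf (meanGain μ t s) ((reportMeasure Λ F_D).restrict (Ioi t)) (Real.exp θ - 1) -
          (reportMeasure Λ F_D).real (Ioi t)) *
        (mgf (meanGain μ t s) ((reportMeasure Λ F_D).restrict (Iic t)) (Real.exp θ - 1) /
          (reportMeasure Λ F_D).real (Iic t)) ^ ℓ) := by
  have hP := h.measure_reportedCount_eq t ℓ
  rw [condReported, ProbabilityTheory.cond, lintegral_smul_measure,
    h.setLIntegral_exp_increment, hP, smul_eq_mul, ← ENNReal.ofReal_inv_of_pos,
    ← ENNReal.ofReal_mul (by positivity)]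
  · congr 1
    have h1 : (ℓ.factorial : ℝ) ≠ 0 := by positivity
    rw [mul_inv, inv_div, ← Real.exp_neg, div_pow]
    calc _ = (Real.exp (-((reportMeasure Λ F_D).real (Ioi t) - Λ.real (Icc 0 1))) * Real.exp
        (mgf (meanGain μ t s) ((reportMeasure Λ F_D).restrict (Ioi t)) (Real.exp θ - 1) -
          Λ.real (Icc 0 1))) *
        (mgf (meanGain μ t s) ((reportMeasure Λ F_D).restrict (Iic t)) (Real.exp θ - 1) ^ ℓ /
          (reportMeasure Λ F_D).real (Iic t) ^ ℓ) * (ℓ.factorial / ℓ.factorial : ℝ) := by ring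
      _ = _ := by
        rw [div_self h1, mul_one, ← Real.exp_add]
        congr 2
        ring
  · rw [hP] at hℓ
    exact ENNReal.ofReal_pos.1 (pos_iff_ne_zero.2 hℓ)

theorem IsModel.integrable_exp_increment (h : IsModel P T D L Λ F_D μ)
    (hℓ : P {ω | reportedCount T D t ω = ℓ} ≠ 0) (θ : ℝ) :
    Integrable (fun ω => Real.exp (θ * increment T D L t s ω)) (condReported P T D t ℓ) := by
  refine ⟨(h.aemeasurable_increment_condReported.const_mul θ).exp.aestronglyMeasurable, ?_⟩
  rw [hasFiniteIntegral_iff_ofReal (Filter.Eventually.of_forall fun ω => (Real.exp_pos _).le),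
    h.lintegral_exp_increment_condReported hℓ]
  exact ENNReal.ofReal_lt_top

theorem IsModel.mgf_increment (h : IsModel P T D L Λ F_D μ)
    (hℓ : P {ω | reportedCount T D t ω = ℓ} ≠ 0) (θ : ℝ) :
    mgf (increment T D L t s) (condReported P T D t ℓ) θ = Real.exp
        (mgf (meanGain μ t s) ((reportMeasure Λ F_D).restrict (Ioi t)) (Real.exp θ - 1) -
          (reportMeasure Λ F_D).real (Ioi t)) *
        (mgf (meanGain μ t s) ((reportMeasure Λ F_D).restrict (Iic t)) (Real.exp θ - 1) /
          (reportMeasure Λ F_D).real (Iic t)) ^ ℓ := by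
  have h0 : 0 ≤ mgf (meanGain μ t s) ((reportMeasure Λ F_D).restrict (Iic t)) (Real.exp θ - 1) :=
    mgf_nonneg
  rw [mgf, integral_eq_lintegral_of_nonneg_ae
    (Filter.Eventually.of_forall fun ω => (Real.exp_pos _).le)
    (h.integrable_exp_increment hℓ θ).aestronglyMeasurable,
    h.lintegral_exp_increment_condReported hℓ, ENNReal.toReal_ofReal (by positivity)]

theorem IsModel.reportMeasure_Iic_ne_zero (h : IsModel P T D L Λ F_D μ)
    (hℓ : P {ω | reportedCount T D t ω = ℓ} ≠ 0) (hℓ0 : ℓ ≠ 0) :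
    (reportMeasure Λ F_D).real (Iic t) ≠ 0 := by
  intro h0
  refine hℓ ?_
  rw [h.measure_reportedCount_eq, h0, zero_pow hℓ0]
  simp

/-- The cumulant generating function of the increment given the number of reported clusters. -/
theorem IsModel.cgf_increment (h : IsModel P T D L Λ F_D μ)
    (hℓ : P {ω | reportedCount T D t ω = ℓ} ≠ 0) :
    ∃ c : ℝ, cgf (increment T D L t s) (condReported P T D t ℓ) = fun θ =>
      (fun x => mgf (meanGain μ t s) ((reportMeasure Λ F_D).restrict (Ioi t)) x +
        ℓ * cgf (meanGain μ t s) ((reportMeasure Λ F_D).restrict (Iic t)) x)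
          (Real.exp θ - 1) + c := by
  have := h.isFiniteMeasure_reportMeasure
  have := h.isLocallyFiniteMeasure_cluster
  refine ⟨-(reportMeasure Λ F_D).real (Ioi t) -
    ℓ * Real.log ((reportMeasure Λ F_D).real (Iic t)), ?_⟩
  funext θ
  rw [cgf, h.mgf_increment hℓ]
  -- For `ℓ = 0` the logarithms carry the factor `0`, so `R` may vanish; otherwise `hℓ` makes the
  -- reported mass nonzero and the logarithm splits.
  rcases eq_or_ne ℓ 0 with rfl | hℓ0
  · simp [sub_eq_add_neg]
  · have h0 := h.reportMeasure_Iic_ne_zero hℓ hℓ0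
    have hne : (reportMeasure Λ F_D).restrict (Iic t) ≠ 0 := by
      intro hz
      apply h0
      rw [← measureReal_restrict_apply_univ, hz]
      simp
    have hpos := mgf_pos' hne
      (integrable_exp_mul_meanGain (μ := μ) (K := (reportMeasure Λ F_D).restrict (Iic t)) t s
        (Real.exp θ - 1))
    rw [Real.log_mul (Real.exp_pos _).ne' (pow_ne_zero _ (div_ne_zero hpos.ne' h0)), Real.log_exp,
      Real.log_pow, Real.log_div hpos.ne' h0]
    simp only [cgf]
    ring

theorem IsModel.zero_mem_interior_integrableExpSet (h : IsModel P T D L Λ F_D μ)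
    (hℓ : P {ω | reportedCount T D t ω = ℓ} ≠ 0) :
    0 ∈ interior (integrableExpSet (increment T D L t s) (condReported P T D t ℓ)) := by
  have hU : integrableExpSet (increment T D L t s) (condReported P T D t ℓ) = univ :=
    eq_univ_of_forall fun θ => h.integrable_exp_increment hℓ θ
  simp [hU]

/-- The conditional mean and variance of the increment, in terms of the moments of `meanGain`. -/
theorem IsModel.mean_variance_increment (h : IsModel P T D L Λ F_D μ)
    (hℓ : P {ω | reportedCount T D t ω = ℓ} ≠ 0) :
    predictor P T D L t s ℓ =
      ∫ u in Ioi t, meanGain μ t s u ∂(reportMeasure Λ F_D) +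
        ℓ * ((∫ u in Iic t, meanGain μ t s u ∂(reportMeasure Λ F_D)) /
          (reportMeasure Λ F_D).real (Iic t)) ∧
    variance (increment T D L t s) (condReported P T D t ℓ) =
      ∫ u in Ioi t, meanGain μ t s u ^ 2 ∂(reportMeasure Λ F_D) +
        ℓ * ((∫ u in Iic t, meanGain μ t s u ^ 2 ∂(reportMeasure Λ F_D)) /
          (reportMeasure Λ F_D).real (Iic t) -
          ((∫ u in Iic t, meanGain μ t s u ∂(reportMeasure Λ F_D)) /
            (reportMeasure Λ F_D).real (Iic t)) ^ 2) + predictor P T D L t s ℓ := by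
  have := h.isFiniteMeasure_reportMeasure
  have := h.isLocallyFiniteMeasure_cluster
  have : IsProbabilityMeasure (condReported P T D t ℓ) := cond_isProbabilityMeasure hℓ
  have hint := h.zero_mem_interior_integrableExpSet (s := s) hℓ
  obtain ⟨c, hc⟩ := h.cgf_increment (s := s) hℓ
  have hI : ∀ (K : Measure ℝ≥0) [IsFiniteMeasure K] (x : ℝ),
      x ∈ interior (integrableExpSet (meanGain μ t s) K) := by
    intro K _ x
    simp [integrableExpSet_meanGain]
  set KU := (reportMeasure Λ F_D).restrict (Ioi t) with hKU
  set KR := (reportMeasure Λ F_D).restrict (Iic t) with hKR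
  have hφ1 : ∀ x, AnalyticAt ℝ (mgf (meanGain μ t s) KU) x := fun x => analyticAt_mgf (hI KU x)
  have hφ2 : ∀ x, AnalyticAt ℝ (fun x => (ℓ : ℝ) * cgf (meanGain μ t s) KR x) x := fun x =>
    analyticAt_const.mul (analyticAt_cgf (hI KR x))
  have hφ : ∀ x, AnalyticAt ℝ (fun x => mgf (meanGain μ t s) KU x +
      ℓ * cgf (meanGain μ t s) KR x) x := fun x => (hφ1 x).add (hφ2 x)
  have hd1 : deriv (fun x => mgf (meanGain μ t s) KU x + ℓ * cgf (meanGain μ t s) KR x) 0 =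
      ∫ u, meanGain μ t s u ∂KU + ℓ * ((∫ u, meanGain μ t s u ∂KR) /
        (reportMeasure Λ F_D).real (Iic t)) := by
    rw [deriv_fun_add (hφ1 0).differentiableAt (hφ2 0).differentiableAt, deriv_mgf_zero (hI KU 0),
      deriv_const_mul_field, deriv_cgf_zero (hI KR 0), hKR, measureReal_restrict_apply_univ]
  have hd2 : iteratedDeriv 2 (fun x => mgf (meanGain μ t s) KU x +
      ℓ * cgf (meanGain μ t s) KR x) 0 =
      ∫ u, meanGain μ t s u ^ 2 ∂KU + ℓ * ((∫ u, meanGain μ t s u ^ 2 ∂KR) /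
        (reportMeasure Λ F_D).real (Iic t) - ((∫ u, meanGain μ t s u ∂KR) /
        (reportMeasure Λ F_D).real (Iic t)) ^ 2) := by
    rw [iteratedDeriv_fun_add (hφ1 0).contDiffAt (hφ2 0).contDiffAt,
      iteratedDeriv_mgf_zero (hI KU 0), iteratedDeriv_const_mul_field,
      iteratedDeriv_two_cgf (hI KR 0), deriv_cgf_zero (hI KR 0)]
    simp [hKR]
  have hmean : predictor P T D L t s ℓ =
      deriv (cgf (increment T D L t s) (condReported P T D t ℓ)) 0 := by
    rw [deriv_cgf_zero hint, predictor]
    simp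
  have hvar : variance (increment T D L t s) (condReported P T D t ℓ) =
      iteratedDeriv 2 (cgf (increment T D L t s) (condReported P T D t ℓ)) 0 := by
    rw [iteratedDeriv_two_cgf_eq_integral hint, ← hmean,
      variance_eq_integral h.aemeasurable_increment_condReported]
    simp [predictor]
  have hmean' : predictor P T D L t s ℓ = ∫ u, meanGain μ t s u ∂KU +
      ℓ * ((∫ u, meanGain μ t s u ∂KR) / (reportMeasure Λ F_D).real (Iic t)) := by
    rw [hmean, hc, deriv_comp_exp_sub_one_add_const_zero hφ, hd1]
  refine ⟨hmean', ?_⟩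
  rw [hvar, hc, iteratedDeriv_two_comp_exp_sub_one_add_const_zero hφ, hd2, hmean', hd1]

end Conditional

/-! ### Identification of the integrals `A_i` and `B_i`. -/

theorem reportedIntegral_eq (c : ℝ) (t s : ℝ≥0) (i : ℕ) :
    reportedIntegral Λ F_D μ c t s i =
      (∫ u in Iic t, meanGain μ t s u ^ i ∂(reportMeasure Λ F_D)) / c := by
  rw [reportedIntegral, show Icc 0 t = Iic t from Icc_bot]
  rfl

/-- For a report time `u = v + r > t`, truncation makes the left end `t - u` zero, leaving `μ(0,
t+s-u]`. -/
theorem IsModel.unreportedIntegral_eq (h : IsModel P T D L Λ F_D μ) {t : ℝ≥0} (ht : 1 ≤ t)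
    (s : ℝ≥0) {i : ℕ} (hi : i ≠ 0) :
    unreportedIntegral Λ F_D μ t s i =
      ∫ u in Ioi t, meanGain μ t s u ^ i ∂(reportMeasure Λ F_D) := by
  have := h.isFiniteMeasure_restrict
  have := h.isProbabilityMeasure_delay
  have := h.isFiniteMeasure_reportMeasure
  have := h.isLocallyFiniteMeasure_cluster
  have hint : Integrable ((Ioi t).indicator fun u => meanGain μ t s u ^ i)
      (Measure.conv (Λ.restrict (Icc 0 1)) F_D) := by
    refine Integrable.indicator (μ := reportMeasure Λ F_D) ?_ measurableSet_Ioi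
    refine Integrable.of_bound ((measurable_meanGain t s).pow_const i).aestronglyMeasurable
      (μ.real (Ioc 0 (t + s)) ^ i) (Filter.Eventually.of_forall fun u => ?_)
    rw [Real.norm_of_nonneg (pow_nonneg (meanGain_nonneg _ _ _ _) i)]
    exact pow_le_pow_left₀ (meanGain_nonneg _ _ _ _) (meanGain_le t s u) i
  rw [unreportedIntegral, ← integral_indicator measurableSet_Ioi, reportMeasure,
    integral_conv hint]
  refine setIntegral_congr_fun measurableSet_Icc fun v hv => ?_
  rw [← integral_indicator measurableSet_Ioc]
  refine integral_congr_ae (Filter.Eventually.of_forall fun r => ?_)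
  have hvt : v ≤ t := hv.2.trans ht
  -- Truncated subtraction is genuine here, since `v ≤ 1 ≤ t`.
  have hlt : t - v < r ↔ t < v + r := tsub_lt_iff_left hvt
  simp only [indicator, mem_Ioc, mem_Ioi, hlt]
  by_cases h1 : t < v + r
  · simp only [h1, true_and, if_true, meanGain, tsub_eq_zero_of_le h1.le]
    by_cases h2 : r ≤ t + s - v
    · rw [if_pos h2, tsub_add_eq_tsub_tsub]
    -- Reports after `t + s` gain nothing: the term is `0 ^ i`, which is `0` because `i ≠ 0`.
    · rw [if_neg h2, tsub_add_eq_tsub_tsub, tsub_eq_zero_of_le (not_le.1 h2).le]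
      simp [hi]
  · simp [h1]

end Model

end DelayedCluster

theorem lemma3p4 {Ω : Type*} [MeasurableSpace Ω] (P : Measure Ω) [IsProbabilityMeasure P]
    (T : ℕ → Ω → ℝ≥0∞) (D : ℕ → Ω → ℝ≥0) (L : ℕ → ℝ≥0 → Ω → ℝ) (Λ F_D μ : Measure ℝ≥0)
    (hmodel : IsModel P T D L Λ F_D μ)
    (t s : ℝ≥0) (ht : 1 ≤ t) (hs : 0 < s) (ℓ : ℕ)
    (hℓ : P {ω | reportedCount T D t ω = ℓ} ≠ 0) :
    Integrable (fun ω => (reportedCount T D t ω : ℝ)) P ∧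
    MemLp (increment T D L t s) 2 (condReported P T D t ℓ) ∧
    predictor P T D L t s ℓ =
      ℓ * reportedIntegral Λ F_D μ (meanReported P T D t) t s 1
        + unreportedIntegral Λ F_D μ t s 1 ∧
    variance (increment T D L t s) (condReported P T D t ℓ) =
      predictor P T D L t s ℓ
        - ℓ * reportedIntegral Λ F_D μ (meanReported P T D t) t s 1 ^ 2
        + ℓ * reportedIntegral Λ F_D μ (meanReported P T D t) t s 2
        + unreportedIntegral Λ F_D μ t s 2 := by
  obtain ⟨hmean, hvar⟩ := hmodel.mean_variance_increment (s := s) hℓ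
  refine ⟨hmodel.integrable_reportedCount t, ?_, ?_, ?_⟩
  · exact memLp_of_mem_interior_integrableExpSet
      (hmodel.zero_mem_interior_integrableExpSet (s := s) hℓ) 2
  · rw [hmean, reportedIntegral_eq, hmodel.unreportedIntegral_eq ht s one_ne_zero,
      hmodel.meanReported_eq]
    simp only [pow_one]
    ring
  · rw [hvar, reportedIntegral_eq, reportedIntegral_eq,
      hmodel.unreportedIntegral_eq ht s two_ne_zero, hmodel.meanReported_eq]
    simp only [pow_one]
    ring
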